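/- Factorization of the stability polynomial of a ring system. Let $n>2$ and let $D_n=\langle r,s\rangle$ act on $\mathbb R^2$ by its standard representation: $r$ is the rotation by $2\pi/n$ about the origin $O$ and $s$ is the reflection $(u,v)\mapsto(-u,v)$. A *ring system of type* $(a,b,c)$ is a finite $D_n$-invariant set $X\subset\mathbb R^2$ with at least two points whose $D_n$-orbits are $a\in\{0,1\}$ times the centre $\{O\}$, $b$ regular $n$-gons and $c$ semiregular $2n$-gons (orbits of points on no reflection line). Let $x=(x_1,\dots,x_N)$ be a configuration of $N$ distinct points with $X=\{x_1,\dots,x_N\}$ a ring system of type $(a,b,c)$, and let $m_1,\dots,m_N\in\mathbb R\setminus\{0\}$ be masses (or vorticities) that are constant on each $D_n$-orbit. Identify the space $\Gamma(E)$ of planar displacements of $X$ (sections of $E=T\mathbb R^2|_X$) with $\mathbb R^{2N}$ by $\delta\mapsto(\delta(x_1),\dots,\delta(x_N))$. Put $M=\mathrm{diag}(m_1I_2,\dots,m_NI_2)$, let $J$ be the rotation by $\pi/2$ in each tangent plane, and let $\langle\delta,\epsilon\rangle_M=\sum_i m_i\,\delta(x_i)\cdot\epsilon(x_i)$ (possibly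 indefinite). Let $$U_\gamma(q)=\frac1{2\gamma+2}\sum_{i<j}m_im_j\|q_i-q_j\|^{2\gamma+2}\ (\gamma\in\mathbb R,\ \gamma\ne-1),\qquad H_{-1}(q)=-\sum_{i<j}m_im_j\ln\|q_i-q_j\|,$$ and let $A$ be $M^{-1}D\nabla U_\gamma(x)$ ($N$-body problem) or $M^{-1}D\nabla H_{-1}(x)$ ($N$-vortex problem). For $\omega\in\mathbb R\setminus\{0\}$, in coordinates rotating with angular velocity $\omega$, the Hamiltonians are $\frac12\nu^TM^{-1}\nu+\omega x^TJ\nu+U_\gamma(x)$ and $\frac\omega2x^TMx+H_{-1}(x)$; a *relative equilibrium* is a critical point of these. The linearizations at $x$ are $$L_\gamma=\begin{pmatrix}-\omega J&M^{-1}\\-D\nabla U_\gamma(x)&-\omega J\end{pmatrix},\qquad L_{-1}=J(\omega I+A),$$ and the *stability polynomials* are $P_\gamma(\lambda)=\det(\lambda I_{4N}-L_\gamma)$ and $P_{-1}(\lambda)=\det(\lambda I_{2N}-L_{-1})$. Below, $x$ is not assumed to be a relative equilibrium except where this is said. There is an $\langle\cdot,\cdot\rangle_M$-orthogonal basis of $\Gamma(E)$,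 independent of $\gamma$, of $\omega$ and of which of the two problems is considered, such that for each of the above operators $A$ and every scalar $\kappa$ the matrix of $A+\kappa J$ is block diagonal with diagonal blocks $$\begin{pmatrix}B_j&\kappa I\\-\kappa I&C_j\end{pmatrix}\qquad(B_j,\ C_j\text{ independent of }\kappa),$$ namely: one ($n$ odd) or two ($n$ even) blocks of size $2(b+2c)$; $(n-3)/2$ ($n$ odd) or $n/2-2$ ($n$ even) blocks of size $4(b+2c)$; and one block, the last one, of size $2(a+2b+4c)$. Consequently the following hold. 1. ($N$-body.) $P_\gamma(\lambda)=\prod_jQ_j(\lambda^2)$ with real polynomials $Q_j$, one for each block, where $\deg Q_j$ (the degree in the variable $\lambda^2$) is the size of the $j$-th block, and $$Q_j(\lambda^2)=\det\begin{pmatrix}B_j+(\lambda^2-\omega^2)I&2\lambda\omega I\\-2\lambda\omega I&C_j+(\lambda^2-\omega^2)I\end{pmatrix}.$$ 2. ($N$-vortex.) $P_{-1}(\lambda)=\prod_jQ_j(\lambda)$, where $\deg Q_j$ is the size of the $j$-th block and $$Q_j(\lambda)=\det\begin{pmatrix}B_j+\omega I&\lambda I\\-\lambda I&C_j+\omega I\end{pmatrix}.$$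 3. (Translations.) The horizontal and vertical translations $\delta_h$, $\delta_v=J\delta_h$ satisfy $A\delta_h=A\delta_v=0$, and they split a factor of degree two off the polynomial $Q$ of the last block: $(z+\omega^2)^2\mid Q(z)$, $z=\lambda^2$, for the $N$-body problem, and $\lambda^2+\omega^2\mid Q(\lambda)$ for the $N$-vortex problem. 4. (Rotation and homogeneity.) If $x$ is a relative equilibrium, then $x$ and $Jx$, viewed as displacements, are eigenvectors of $A$: $Ax=(2\gamma+1)\omega^2x$ and $AJx=\omega^2Jx$ for the $N$-body problem, and $Ax=\omega x$ and $AJx=-\omega Jx$ for the $N$-vortex problem. They split a factor of degree two off the polynomial $Q$ of the first block of size $2(b+2c)$: $z\,(z+(2\gamma+4)\omega^2)\mid Q(z)$, $z=\lambda^2$, and $\lambda^2\mid Q(\lambda)$, respectively. 5. The same basis can be chosen to contain $\delta_v,\delta_h$ if $\sum_im_i\neq0$, and $Jx,x$ if $\sum_im_i\|x_i\|^2\ne0$ (in particular both, if all $m_i$ have the same sign). In the first case the last block of $A+\kappa J$ splits off the $2\times2$ block $\begin{pmatrix}0&\kappa\\-\kappa&0\end{pmatrix}$. In the second case, if $x$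 is a relative equilibrium, the first block splits off $\begin{pmatrix}\omega^2&\kappa\\-\kappa&(2\gamma+1)\omega^2\end{pmatrix}$ for the $N$-body problem, and $\begin{pmatrix}-\omega&\kappa\\-\kappa&\omega\end{pmatrix}$ for the $N$-vortex problem. -/

import Mathlib

open scoped BigOperators Polynomial

noncomputable section

namespace RingSystem

/-! ### The plane, configurations and displacements -/

/-- The Euclidean plane `ℝ²`. -/
abbrev Plane : Type := EuclideanSpace ℝ (Fin 2)

/-- `ℝ^{2N} = (ℝ²)^N` with its Euclidean inner product.  Its points are the configurations
`x = (x₁, …, x_N)`.  For a configuration of distinct points with point set `X = {x₁, …, x_N}` it is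
also the space `Γ(E)` of planar displacements of `X`, that is, of sections of `E = Tℝ²|_X`: the
displacement `δ` is recorded as `(δ(x₁), …, δ(x_N))`. -/
abbrev Config (N : ℕ) : Type := PiLp 2 (fun _ : Fin N => Plane)

/-- Rotation of the plane by `π/2`. -/
def rotQuarter : Plane →ₗ[ℝ] Plane where
  toFun v := !₂[-v 1, v 0]
  map_add' u v := by
    ext i
    fin_cases i <;> simp [add_comm]
  map_smul' s v := by
    ext i
    fin_cases i <;> simp

/-- The operator `J`: rotation by `π/2` in each tangent plane. -/
def J (N : ℕ) : Config N →ₗ[ℝ] Config N where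
  toFun q := WithLp.toLp 2 fun i => rotQuarter (q i)
  map_add' p q := by
    ext1 i
    simp
  map_smul' s q := by
    ext1 i
    simp

/-- `diag(w₁ I₂, …, w_N I₂)`.  The mass matrix is `M = diagOp m`, and `M⁻¹ = diagOp m⁻¹`. -/
def diagOp {N : ℕ} (w : Fin N → ℝ) : Config N →ₗ[ℝ] Config N where
  toFun q := WithLp.toLp 2 fun i => w i • q i
  map_add' p q := by
    ext1 i
    simp
  map_smul' s q := by
    ext1 i
    simp [smul_comm s (w i)]

/-- The (possibly indefinite) mass inner product `⟨δ, ε⟩_M = ∑ᵢ mᵢ δ(xᵢ) · ε(xᵢ)`. -/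
def massInner {N : ℕ} (m : Fin N → ℝ) (δ ε : Config N) : ℝ :=
  ∑ i, m i * inner ℝ (δ i) (ε i)

/-- The horizontal translation `δ_h(x) = e₁` for all `x`. -/
def transH (N : ℕ) : Config N := WithLp.toLp 2 fun _ => !₂[1, 0]

/-- The vertical translation `δ_v(x) = e₂` for all `x`. -/
def transV (N : ℕ) : Config N := WithLp.toLp 2 fun _ => !₂[0, 1]

/-! ### Dihedral symmetry and ring systems -/

/-- Rotation matrix. -/
def rotMatrix (θ : ℝ) : Matrix (Fin 2) (Fin 2) ℝ :=
  !![Real.cos θ, -Real.sin θ; Real.sin θ, Real.cos θ]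

/-- The standard representation `σ` of `D_n`: `r` acts as the rotation by `2π/n`, and `s` as the
reflection `(u, v) ↦ (-u, v)`.  The element `sr j` of `DihedralGroup n` is `s * r ^ j`. -/
def stdRep (n : ℕ) : DihedralGroup n → Matrix (Fin 2) (Fin 2) ℝ
  | DihedralGroup.r j => rotMatrix (2 * Real.pi * (j.val : ℝ) / (n : ℝ))
  | DihedralGroup.sr j => !![-1, 0; 0, 1] * rotMatrix (2 * Real.pi * (j.val : ℝ) / (n : ℝ))

/-- The action of `g ∈ D_n` on the plane through `σ`. -/
def act {n : ℕ} (g : DihedralGroup n) (v : Plane) : Plane :=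
  WithLp.toLp 2 ((stdRep n g).mulVec (WithLp.ofLp v))

/-- The `D_n`-orbit of a point of the plane. -/
def orbit (n : ℕ) (v : Plane) : Set Plane := Set.range fun g : DihedralGroup n => act g v

/-- `S` is the vertex set of a regular `n`-gon centred at the origin. -/
def IsRegularGon (n : ℕ) (S : Set Plane) : Prop :=
  ∃ v : Plane, v ≠ 0 ∧ S = Set.range fun j : ZMod n => act (DihedralGroup.r j) v

/-- `S` is the vertex set of a (`D_n`-symmetric) semiregular `2n`-gon centred at the origin: the
`D_n`-orbit of a point lying on none of the reflection lines (and hence fixed by no `g ≠ 1`). -/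
def IsSemiregularGon (n : ℕ) (S : Set Plane) : Prop :=
  ∃ v : Plane, (∀ g : DihedralGroup n, g ≠ 1 → act g v ≠ v) ∧ S = orbit n v

/-- `X` is a ring system of type `(a, b, c)` (for the action `σ` of `D_n`): a finite `D_n`-symmetric
set with at least two points, whose decomposition into `D_n`-orbits has `a` orbits consisting of the
centre alone, `b` orbits that are regular `n`-gons and `c` orbits that are semiregular `2n`-gons. -/
structure IsRingSystem (n : ℕ) (X : Set Plane) (a b c : ℕ) : Prop where
  finite : X.Finite
  nontrivial : X.Nontrivial
  symmetric : ∀ g : DihedralGroup n, ∀ v ∈ X, act g v ∈ X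
  card_centre : {S | S ∈ orbit n '' X ∧ S = {0}}.ncard = a
  card_regular : {S | S ∈ orbit n '' X ∧ IsRegularGon n S}.ncard = b
  card_semiregular : {S | S ∈ orbit n '' X ∧ IsSemiregularGon n S}.ncard = c

/-! ### The `N`-body and `N`-vortex problems -/

/-- The potential `U_γ(q) = (2γ+2)⁻¹ ∑_{i<j} mᵢ mⱼ ‖qᵢ - qⱼ‖^{2γ+2}` of the `N`-body problem. -/
def potential {N : ℕ} (γ : ℝ) (m : Fin N → ℝ) (q : Config N) : ℝ :=
  1 / (2 * γ + 2) * ∑ i, ∑ j ∈ Finset.Ioi i, m i * m j * ‖q i - q j‖ ^ (2 * γ + 2)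

/-- The Hamiltonian `H₋₁(q) = -∑_{i<j} mᵢ mⱼ ln ‖qᵢ - qⱼ‖` of the `N`-vortex problem. -/
def vortexH {N : ℕ} (m : Fin N → ℝ) (q : Config N) : ℝ :=
  -∑ i, ∑ j ∈ Finset.Ioi i, m i * m j * Real.log ‖q i - q j‖

/-- The Hamiltonian of the `N`-body problem in coordinates rotating with angular velocity `ω`:
`½ νᵀM⁻¹ν + ω xᵀJν + U_γ(x)`. -/
def rotHamiltonian {N : ℕ} (γ : ℝ) (m : Fin N → ℝ) (ω : ℝ) (z : Config N × Config N) : ℝ :=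
  1 / 2 * inner ℝ z.2 (diagOp m⁻¹ z.2) + ω * inner ℝ z.1 (J N z.2) + potential γ m z.1

/-- The Hamiltonian of the `N`-vortex problem in rotating coordinates: `(ω/2) xᵀMx + H₋₁(x)`. -/
def rotVortexHamiltonian {N : ℕ} (m : Fin N → ℝ) (ω : ℝ) (x : Config N) : ℝ :=
  ω / 2 * inner ℝ x (diagOp m x) + vortexH m x

/-- `x` is (the configuration of) a relative equilibrium of the `N`-body problem. -/
def IsRelEquilibrium {N : ℕ} (γ : ℝ) (m : Fin N → ℝ) (ω : ℝ) (x : Config N) : Prop :=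
  ∃ ν : Config N,
    HasFDerivAt (rotHamiltonian γ m ω) (0 : Config N × Config N →L[ℝ] ℝ) (x, ν)

/-- `x` is a relative equilibrium of the `N`-vortex problem. -/
def IsVortexRelEquilibrium {N : ℕ} (m : Fin N → ℝ) (ω : ℝ) (x : Config N) : Prop :=
  HasFDerivAt (rotVortexHamiltonian m ω) (0 : Config N →L[ℝ] ℝ) x

/-- The Hessian operator `D∇F(x)`. -/
def hess {N : ℕ} (F : Config N → ℝ) (x : Config N) : Config N →ₗ[ℝ] Config N :=
  (fderiv ℝ (gradient F) x : Config N →L[ℝ] Config N)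

/-- `A = M⁻¹ D∇U_γ(x)`. -/
def opA {N : ℕ} (γ : ℝ) (m : Fin N → ℝ) (x : Config N) : Config N →ₗ[ℝ] Config N :=
  diagOp m⁻¹ ∘ₗ hess (potential γ m) x

/-- `A = M⁻¹ D∇H₋₁(x)`. -/
def vortexOpA {N : ℕ} (m : Fin N → ℝ) (x : Config N) : Config N →ₗ[ℝ] Config N :=
  diagOp m⁻¹ ∘ₗ hess (vortexH m) x

/-- The linearization of the `N`-body problem in rotating coordinates,
`L_γ(x) = [[-ωJ, M⁻¹], [-D∇U_γ(x), -ωJ]]`. -/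
def linearization {N : ℕ} (γ : ℝ) (m : Fin N → ℝ) (ω : ℝ) (x : Config N) :
    Config N × Config N →ₗ[ℝ] Config N × Config N :=
  LinearMap.prod
    (LinearMap.coprod (-(ω • J N)) (diagOp m⁻¹))
    (LinearMap.coprod (-hess (potential γ m) x) (-(ω • J N)))

/-- The linearization of the `N`-vortex problem in rotating coordinates,
`L₋₁(x) = J (ω I + M⁻¹ D∇H₋₁(x))`. -/
def vortexLinearization {N : ℕ} (m : Fin N → ℝ) (ω : ℝ) (x : Config N) :
    Config N →ₗ[ℝ] Config N :=
  J N ∘ₗ (ω • LinearMap.id + vortexOpA m x)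

/-- The stability polynomial `P_γ(λ) = det(λ I_{4N} - L_γ(x))`. -/
def stabilityPoly {N : ℕ} (γ : ℝ) (m : Fin N → ℝ) (ω : ℝ) (x : Config N) : ℝ[X] :=
  (linearization γ m ω x).charpoly

/-- The stability polynomial `P₋₁(λ) = det(λ I_{2N} - L₋₁(x))`. -/
def vortexStabilityPoly {N : ℕ} (m : Fin N → ℝ) (ω : ℝ) (x : Config N) : ℝ[X] :=
  (vortexLinearization m ω x).charpoly

/-! ### The block structure -/

/-- One block (`n` odd) or two blocks (`n` even) of size `2(b+2c)`. -/
def numSmall (n : ℕ) : ℕ := if Even n then 2 else 1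

/-- `(n-3)/2` blocks (`n` odd) or `n/2-2` blocks (`n` even) of size `4(b+2c)`. -/
def numMiddle (n : ℕ) : ℕ := if Even n then n / 2 - 2 else (n - 3) / 2

/-- The index set of the diagonal blocks. -/
abbrev Block (n : ℕ) : Type := Fin (numSmall n) ⊕ Fin (numMiddle n) ⊕ Unit

/-- Half the size of each diagonal block. -/
def halfSize (n a b c : ℕ) : Block n → ℕ
  | Sum.inl _ => b + 2 * c
  | Sum.inr (Sum.inl _) => 2 * (b + 2 * c)
  | Sum.inr (Sum.inr _) => a + 2 * b + 4 * c

/-- The first of the blocks of size `2(b+2c)`. -/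
def firstBlock (n : ℕ) : Block n :=
  Sum.inl ⟨0, by unfold numSmall; split <;> norm_num⟩

/-- The block of size `2(a+2b+4c)`. -/
def lastBlock (n : ℕ) : Block n := Sum.inr (Sum.inr ())

/-- The index set of a basis arranged in blocks, each block consisting of two halves. -/
abbrev BlockIndex (n a b c : ℕ) : Type :=
  (j : Block n) × (Fin (halfSize n a b c j) ⊕ Fin (halfSize n a b c j))

/-- For every scalar `s`, the matrix of `A + s J` in the basis `v` is block diagonal, with diagonal
blocks `[[B_j, s I], [-s I, C_j]]`. -/
def HasBlockForm {n a b c N : ℕ} (v : Module.Basis (BlockIndex n a b c) ℝ (Config N))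
    (A : Config N →ₗ[ℝ] Config N)
    (B C : (j : Block n) → Matrix (Fin (halfSize n a b c j)) (Fin (halfSize n a b c j)) ℝ) :
    Prop :=
  ∀ s : ℝ, LinearMap.toMatrix v v (A + s • J N) =
    Matrix.blockDiagonal' fun j => Matrix.fromBlocks (B j) (s • 1) (-(s • 1)) (C j)

/-- The `i`-th row and the `i`-th column of a matrix vanish off the diagonal. -/
def SplitsAt {d : ℕ} (B : Matrix (Fin d) (Fin d) ℝ) (i : Fin d) : Prop :=
  ∀ k, k ≠ i → B k i = 0 ∧ B i k = 0

end RingSystem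

end

open RingSystem

open RingSystem

namespace RingSystem

/-! ### Determinants of block matrices -/

section Determinants

variable {R : Type*} [CommRing R] {n : Type*} [Fintype n] [DecidableEq n]

/-! The group `D_n` acts on displacements by `(gδ)(x) = g δ(g⁻¹x)` (`rep`). Both energies depend
only on mutual distances and the masses are constant on orbits, so `A` commutes with this action; it
is also self-adjoint for the mass form. The operator `J` commutes with rotations and anticommutes
with reflections. Split the displacements by the frequency pair `±k` of the rotation subgroup and
then by the sign of `s` (`isoSpace`): `A` preserves every piece, and `J` exchanges the two signs at
a given frequency. A mass-orthogonal basis of one piece followed by its image under `-J` therefore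
gives the block form for all scalars at once (`exists_isAdapted`, `IsAdapted.hasBlockForm`), and the
pieces do not depend on the energy. The mass form may be indefinite, but the pieces are images of
self-adjoint projections, so it stays nondegenerate on each of them and orthogonal bases exist
(`exists_orthogonal_family`).

The block sizes are traces of these projections (`trace_isoProj`). A nontrivial rotation fixes at
most the centre, and the reflection part is traceless because it anticommutes with `J`. So only the
number of points and the presence of the centre matter; the centre contributes to frequency 1 alone.

For the polynomials, elimination against `M⁻¹` gives `det(λ - L_γ) = det(A + (λ² - ω²) + 2λωJ)`, and
`λ - L₋₁ = -J(A + ω + λJ)` with `det(-J) = 1`. On a block the determinant is `det((B + p)(C + p) +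
κ²)`, which sees `κ` only through its square (`det_fromBlocks_smul_one`).

The explicit factors come from a displacement `δ` in the second half of a block such that `δ` and
`Jδ` are both eigenvectors of `A`. They have the same coordinates `β` in the two halves, so `β` is a
common eigenvector of `B` and `C` and yields a divisor of the determinant (`dvd_blockPoly`), even if
`δ` is isotropic. The eigenvectors come from differentiating the translation invariance, rotation
equivariance and homogeneity of the gradient. -/

theorem det_fromBlocks_zero_one_neg_one_zero :
    (Matrix.fromBlocks (0 : Matrix n n R) (1 : Matrix n n R) (-1 : Matrix n n R)
      (0 : Matrix n n R)).det = 1 := by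
  have h : (Matrix.fromBlocks (0 : Matrix n n R) (1 : Matrix n n R) (-1 : Matrix n n R)
      (0 : Matrix n n R)) =
      Matrix.fromBlocks 1 1 0 1 * Matrix.fromBlocks 1 0 (-1) 1 * Matrix.fromBlocks 1 1 0 1 := by
    simp [Matrix.fromBlocks_multiply]
  rw [h, Matrix.det_mul, Matrix.det_mul]
  simp

/-- Elimination against the off-diagonal block `B`, with inverse `E`: a column operation clears `A`,
and a swap of the columns makes the matrix block triangular. It is applied with `B = -M⁻¹` and with
`B` a scalar matrix. -/
theorem det_fromBlocks_of_mul_eq_one (A B C D E : Matrix n n R) (hE : B * E = 1) :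
    (Matrix.fromBlocks A B C D).det = B.det * (D * E * A - C).det := by
  have h : Matrix.fromBlocks A B C D * Matrix.fromBlocks (1 : Matrix n n R) 0 (-(E * A)) 1 *
      Matrix.fromBlocks (0 : Matrix n n R) 1 (-1) 0 =
        Matrix.fromBlocks (-B) 0 (-D) (C - D * E * A) := by
    have h1 : B * (E * A) = A := by rw [← Matrix.mul_assoc, hE, Matrix.one_mul]
    simp [Matrix.fromBlocks_multiply, h1, Matrix.mul_assoc, sub_eq_add_neg]
  have h2 := congrArg Matrix.det h
  rw [Matrix.det_mul, Matrix.det_mul, det_fromBlocks_zero_one_neg_one_zero,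
    Matrix.det_fromBlocks_zero₁₂, Matrix.det_fromBlocks_zero₁₂] at h2
  simp only [Matrix.det_one, mul_one] at h2
  rw [h2, ← neg_sub (D * E * A) C, Matrix.det_neg, Matrix.det_neg]
  -- The signs from `det (-B)` and from reversing `C - D * E * A` cancel.
  have : ((-1 : R) ^ Fintype.card n) * (-1) ^ Fintype.card n = 1 := by
    rw [← mul_pow]; simp
  linear_combination (B.det * (D * E * A - C).det) * this

/-- Only `k ^ 2` survives, which is what makes the `N`-body factors polynomials in `λ²`. The halves
are swapped before the elimination so that the product comes out in the order `P * S`. -/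
theorem det_fromBlocks_smul_one {K : Type*} [Field K] (P S : Matrix n n K) (k : K) :
    (Matrix.fromBlocks P (k • 1) (-(k • 1)) S).det = (P * S + (k ^ 2) • 1).det := by
  rcases eq_or_ne k 0 with rfl | hk
  · simp
  · have h1 : (-(k • (1 : Matrix n n K))) * (-(k⁻¹ • 1)) = 1 := by simp [smul_smul, hk]
    rw [← Matrix.det_submatrix_equiv_self (Equiv.sumComm n n), Equiv.sumComm_apply,
      Matrix.fromBlocks_submatrix_sum_swap_sum_swap, det_fromBlocks_of_mul_eq_one _ _ _ _ _ h1,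
      ← Matrix.det_mul]
    congr 1
    simp [mul_sub, smul_smul, hk, sq]

theorem det_blockDiagonal_dep {ι : Type*} [Fintype ι] [DecidableEq ι] {d : ι → Type*}
    [∀ i, Fintype (d i)] [∀ i, DecidableEq (d i)] (M : ∀ i, Matrix (d i) (d i) R) :
    (Matrix.blockDiagonal' M).det = ∏ i, (M i).det := by
  classical
  -- An arbitrary order on the blocks, needed only to view the matrix as block triangular.
  let o : LinearOrder ι := LinearOrder.lift' (Fintype.equivFin ι) (Fintype.equivFin ι).injective
  have h : (Matrix.blockDiagonal' M).BlockTriangular Sigma.fst := by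
    convert! Matrix.blockTriangular_blockDiagonal' M
  rw [h.det_fintype]
  refine Finset.prod_congr rfl fun k _ => ?_
  let e : d k ≃ {a : (i : ι) × d i // a.1 = k} :=
    { toFun := fun y => ⟨⟨k, y⟩, rfl⟩
      invFun := fun a => a.2 ▸ a.1.2
      left_inv := fun y => rfl
      right_inv := by rintro ⟨⟨i, y⟩, rfl⟩; rfl }
  rw [← Matrix.det_submatrix_equiv_self e]
  congr 1
  ext y z
  simp [Matrix.toSquareBlock_def, e]

end Determinants

/-! ### The polynomial of a block -/

/-- The determinant of `(B + p)(C + p) + q`, as a polynomial. -/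
noncomputable def blockPoly {d : ℕ} (B C : Matrix (Fin d) (Fin d) ℝ) (p q : ℝ[X]) : ℝ[X] :=
  ((B.map Polynomial.C + p • (1 : Matrix (Fin d) (Fin d) ℝ[X])) *
    (C.map Polynomial.C + p • (1 : Matrix (Fin d) (Fin d) ℝ[X])) +
      q • (1 : Matrix (Fin d) (Fin d) ℝ[X])).det

/-- Only the square of the coupling has to be polynomial: in the variable `z = λ²` the coupling
`2λω` is not, but its square `4ω²z` is. -/
theorem eval_blockPoly {d : ℕ} (B C : Matrix (Fin d) (Fin d) ℝ) (p q : ℝ[X]) (t k : ℝ)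
    (hk : k ^ 2 = q.eval t) :
    (blockPoly B C p q).eval t =
      (Matrix.fromBlocks (B + p.eval t • 1) (k • 1) (-(k • 1)) (C + p.eval t • 1)).det := by
  rw [det_fromBlocks_smul_one, hk, blockPoly, ← Polynomial.coe_evalRingHom, RingHom.map_det]
  congr 1
  rw [map_add, map_mul, map_add, map_add]
  have h1 (r : ℝ[X]) : (Polynomial.evalRingHom t).mapMatrix
      (r • (1 : Matrix (Fin d) (Fin d) ℝ[X])) = r.eval t • 1 := by
    ext i j
    by_cases hij : i = j <;> simp [hij]
  have h2 (D : Matrix (Fin d) (Fin d) ℝ) :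
      (Polynomial.evalRingHom t).mapMatrix (D.map Polynomial.C) = D := by
    ext i j
    simp
  simp only [h1, h2, Polynomial.coe_evalRingHom]

theorem natDegree_det_le {d k : ℕ} (M : Matrix (Fin d) (Fin d) ℝ[X])
    (hM : ∀ i j, (M i j).natDegree ≤ k) : M.det.natDegree ≤ d * k := by
  rw [Matrix.det_apply]
  refine Polynomial.natDegree_sum_le_of_forall_le _ _ fun g _ => ?_
  have h : (∏ i, M (g i) i).natDegree ≤ d * k := by
    refine (Polynomial.natDegree_prod_le _ _).trans ?_
    simpa using Finset.sum_le_card_nsmul Finset.univ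
      (fun i => (M (g i) i).natDegree) k fun i _ => hM _ _
  rcases Int.units_eq_one_or (Equiv.Perm.sign g) with sg | sg
  · rwa [sg, one_smul]
  · rwa [sg, Units.neg_smul, one_smul, Polynomial.natDegree_neg]

theorem natDegree_blockPoly_le {d : ℕ} (B C : Matrix (Fin d) (Fin d) ℝ) (p q : ℝ[X])
    (hp : p.natDegree ≤ 1) (hq : q.natDegree ≤ 2) : (blockPoly B C p q).natDegree ≤ 2 * d := by
  rw [mul_comm, blockPoly]
  have h1 (r : ℝ[X]) (i j : Fin d) :
      ((r • (1 : Matrix (Fin d) (Fin d) ℝ[X])) i j).natDegree ≤ r.natDegree := by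
    by_cases hij : i = j <;> simp [hij]
  have h2 (D : Matrix (Fin d) (Fin d) ℝ) (i j : Fin d) :
      ((D.map Polynomial.C + p • (1 : Matrix (Fin d) (Fin d) ℝ[X])) i j).natDegree ≤ 1 :=
    Polynomial.natDegree_add_le_of_degree_le (by simp) ((h1 p i j).trans hp)
  refine natDegree_det_le _ fun i j => ?_
  rw [Matrix.add_apply, Matrix.mul_apply]
  refine Polynomial.natDegree_add_le_of_degree_le ?_ ((h1 q i j).trans hq)
  exact Polynomial.natDegree_sum_le_of_forall_le _ _ fun k _ =>
    Polynomial.natDegree_mul_le_of_le (h2 B i k) (h2 C k j)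

/-- Multiplying by the adjugate gives `det M · β = p · adj(M) β`; a nonzero coordinate of the
constant vector `β` is a unit. -/
theorem dvd_det_of_mulVec_eq {d : ℕ} (M : Matrix (Fin d) (Fin d) ℝ[X]) (β : Fin d → ℝ)
    (hβ : β ≠ 0) (p : ℝ[X])
    (h : M.mulVec (fun i => Polynomial.C (β i)) = p • fun i => Polynomial.C (β i)) :
    p ∣ M.det := by
  obtain ⟨i, hi⟩ := Function.ne_iff.mp hβ
  have h1 := congrArg (fun u => M.adjugate.mulVec u i) h
  simp only [Matrix.mulVec_mulVec, Matrix.adjugate_mul, Matrix.smul_mulVec, Matrix.one_mulVec,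
    Matrix.mulVec_smul, Pi.smul_apply, smul_eq_mul] at h1
  have h2 : p ∣ M.det * Polynomial.C (β i) := ⟨_, h1⟩
  have hu : IsUnit (Polynomial.C (β i)) := Polynomial.isUnit_C.mpr (isUnit_iff_ne_zero.mpr hi)
  exact hu.dvd_mul_right.mp h2

theorem dvd_blockPoly {d : ℕ} (B C : Matrix (Fin d) (Fin d) ℝ) (p q : ℝ[X]) (β : Fin d → ℝ)
    (hβ : β ≠ 0) (s t : ℝ) (hB : B.mulVec β = s • β) (hC : C.mulVec β = t • β) :
    (Polynomial.C s + p) * (Polynomial.C t + p) + q ∣ blockPoly B C p q := by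
  refine dvd_det_of_mulVec_eq _ β hβ _ ?_
  have key (D : Matrix (Fin d) (Fin d) ℝ) (r : ℝ) (hD : D.mulVec β = r • β) :
      (D.map Polynomial.C + p • (1 : Matrix (Fin d) (Fin d) ℝ[X])).mulVec
        (fun i => Polynomial.C (β i)) = (Polynomial.C r + p) • fun i => Polynomial.C (β i) := by
    have h1 : (D.map Polynomial.C).mulVec (fun i => Polynomial.C (β i)) =
        Polynomial.C r • fun i => Polynomial.C (β i) := by
      ext1 i
      have := congrArg Polynomial.C (congrFun hD i)
      simpa [Matrix.mulVec, dotProduct] using this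
    rw [Matrix.add_mulVec, h1, Matrix.smul_mulVec, Matrix.one_mulVec, add_smul]
  rw [Matrix.add_mulVec, ← Matrix.mulVec_mulVec, key C t hC, Matrix.mulVec_smul, key B s hB,
    Matrix.smul_mulVec, Matrix.one_mulVec, smul_smul, ← add_smul, mul_comm (Polynomial.C t + p)]

/-- Upper bounds whose sum is attained are all attained. Together with monicity of the
characteristic polynomial this yields the exact degrees without computing leading coefficients block
by block. -/
theorem natDegree_eq_of_prod {ι : Type*} [Fintype ι] (Q : ι → ℝ[X]) (e : ι → ℕ)
    (hle : ∀ j, (Q j).natDegree ≤ e j) (hne : ∏ j, Q j ≠ 0)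
    (hdeg : (∏ j, Q j).natDegree = ∑ j, e j) (j : ι) : (Q j).natDegree = e j := by
  rw [Polynomial.natDegree_prod _ _ fun i hi => (Finset.prod_ne_zero_iff.mp hne) i hi] at hdeg
  exact (Finset.sum_eq_sum_iff_of_le fun i _ => hle i).mp hdeg j (Finset.mem_univ j)

/-! ### Characteristic polynomials of linearizations -/

section Charpoly

variable {V : Type*} [AddCommGroup V] [Module ℝ V]

theorem toMatrix_prod_coprod {ι : Type*} [Fintype ι] [DecidableEq ι] (v : Module.Basis ι ℝ V)
    (A B C D : V →ₗ[ℝ] V) :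
    LinearMap.toMatrix (v.prod v) (v.prod v)
        (LinearMap.prod (LinearMap.coprod A B) (LinearMap.coprod C D)) =
      Matrix.fromBlocks (LinearMap.toMatrix v v A) (LinearMap.toMatrix v v B)
        (LinearMap.toMatrix v v C) (LinearMap.toMatrix v v D) := by
  ext i j
  rcases i with i | i <;> rcases j with j | j <;> simp [LinearMap.toMatrix_apply]

variable [FiniteDimensional ℝ V]

theorem eval_charpoly_eq_det (f : V →ₗ[ℝ] V) (t : ℝ) :
    f.charpoly.eval t = LinearMap.det (t • LinearMap.id - f) := by
  rw [← f.charpoly_toMatrix (Module.finBasis ℝ V), Matrix.eval_charpoly,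
    ← LinearMap.det_toMatrix (Module.finBasis ℝ V)]
  congr 1
  rw [map_sub, map_smul, LinearMap.toMatrix_id, Matrix.scalar_apply,
    Matrix.smul_one_eq_diagonal]

/-- With `K = t + ωJ` the matrix is `[[K, -M'], [H, K]]`. Elimination against `-M'`, whose inverse
is `-M`, leaves `det(M'H + K²)` because `K` commutes with `M'`, and `J² = -1` gives `K² = t² - ω² +
2tωJ`. -/
theorem det_smul_id_sub_linearization (J H M M' : V →ₗ[ℝ] V) (hJ : J * J = -1)
    (hM : M' * M = 1) (hJM : J * M' = M' * J) (ω t : ℝ) :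
    LinearMap.det (t • LinearMap.id - LinearMap.prod (LinearMap.coprod (-(ω • J)) M')
        (LinearMap.coprod (-H) (-(ω • J)))) =
      LinearMap.det (M' * H + (t ^ 2 - ω ^ 2) • (1 : V →ₗ[ℝ] V) + (2 * t * ω) • J) := by
  let b := Module.finBasis ℝ V
  let K : V →ₗ[ℝ] V := t • 1 + ω • J
  have h1 : t • LinearMap.id - LinearMap.prod (LinearMap.coprod (-(ω • J)) M')
        (LinearMap.coprod (-H) (-(ω • J))) =
      LinearMap.prod (LinearMap.coprod K (-M')) (LinearMap.coprod H K) := by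
    refine LinearMap.ext fun z => Prod.ext ?_ ?_
    · simp [K]; abel
    · simp [K]; abel
  have hKM : M' * K = K * M' := by
    simp only [K, mul_add, add_mul, mul_smul_comm, smul_mul_assoc, hJM, mul_one, one_mul]
  have hKK : K * K = (t ^ 2 - ω ^ 2) • (1 : V →ₗ[ℝ] V) + (2 * t * ω) • J := by
    simp only [K, mul_add, add_mul, mul_smul_comm, smul_mul_assoc, hJ, mul_one, one_mul]
    module
  have hE : LinearMap.toMatrix b b (-M') * LinearMap.toMatrix b b (-M) = 1 := by
    rw [← LinearMap.toMatrix_mul, neg_mul_neg, hM, LinearMap.toMatrix_one]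
  rw [h1, ← LinearMap.det_toMatrix (b.prod b), toMatrix_prod_coprod,
    det_fromBlocks_of_mul_eq_one _ _ _ _ _ hE, ← Matrix.det_mul, ← LinearMap.toMatrix_mul,
    ← LinearMap.toMatrix_mul, ← map_sub, ← LinearMap.toMatrix_mul, LinearMap.det_toMatrix]
  congr 1
  have : -M' * (K * -M * K - H) = M' * H + (M' * K) * (M * K) := by noncomm_ring
  rw [this, hKM, mul_assoc, ← mul_assoc M' M K, hM, one_mul, hKK, add_assoc]

end Charpoly

/-! ### Orthogonal families in nondegenerate subspaces -/

/-- Gram–Schmidt for an indefinite form: split off a non-isotropic vector and pass to its orthogonal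
complement in `E`, which is again nondegenerate. The second conclusion lets the first vector split
off be prescribed. -/
theorem exists_orthogonal_family {V : Type*} [AddCommGroup V] [Module ℝ V]
    [FiniteDimensional ℝ V] (F : LinearMap.BilinForm ℝ V) (hF : ∀ u w, F u w = F w u) (d : ℕ) :
    ∀ E : Submodule ℝ V, (∀ u ∈ E, (∀ w ∈ E, F u w = 0) → u = 0) → Module.finrank ℝ E = d →
      (∃ w : Fin d → V, (∀ i, w i ∈ E) ∧ (∀ i j, i ≠ j → F (w i) (w j) = 0) ∧
        ∀ i, F (w i) (w i) ≠ 0) ∧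
      ∀ u ∈ E, F u u ≠ 0 → ∃ (w : Fin d → V) (i : Fin d), w i = u ∧ (∀ i, w i ∈ E) ∧
        (∀ i j, i ≠ j → F (w i) (w j) = 0) ∧ ∀ i, F (w i) (w i) ≠ 0 := by
  induction d with
  | zero =>
    intro E _ hd
    refine ⟨⟨Fin.elim0, fun i => i.elim0, fun i => i.elim0, fun i => i.elim0⟩, fun u hu h => ?_⟩
    rw [Submodule.finrank_eq_zero] at hd
    subst hd
    rw [Submodule.mem_bot] at hu
    simp [hu] at h
  | succ d ih =>
    intro E hE hd
    have step : ∀ u ∈ E, F u u ≠ 0 → ∃ (w : Fin (d + 1) → V) (i : Fin (d + 1)), w i = u ∧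
        (∀ i, w i ∈ E) ∧ (∀ i j, i ≠ j → F (w i) (w j) = 0) ∧ ∀ i, F (w i) (w i) ≠ 0 := by
      intro u hu huu
      let f : Module.Dual ℝ E := (F u).comp E.subtype
      have hf : f ≠ 0 := fun h => huu (by simpa [f] using LinearMap.congr_fun h ⟨u, hu⟩)
      let E' : Submodule ℝ V := (LinearMap.ker f).map E.subtype
      have hmem (y : V) : y ∈ E' ↔ y ∈ E ∧ F u y = 0 := by
        simp [E', f, and_comm]
      have hd' : Module.finrank ℝ E' = d := by
        have h1 := Module.Dual.finrank_ker_add_one_of_ne_zero hf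
        rw [hd] at h1
        have h2 : Module.finrank ℝ E' = Module.finrank ℝ (LinearMap.ker f) :=
          Submodule.finrank_map_subtype_eq _ _
        omega
      have hE' : ∀ y ∈ E', (∀ w ∈ E', F y w = 0) → y = 0 := by
        intro y hy h
        rw [hmem] at hy
        refine hE y hy.1 fun w hw => ?_
        -- Every vector of `E` lies in `E'` up to a multiple of `u`, and `y` is already orthogonal
        -- to `u`.
        have h3 : w - (F u w / F u u) • u ∈ E' := by
          rw [hmem]
          refine ⟨E.sub_mem hw (E.smul_mem _ hu), ?_⟩
          simp [huu]
        have h4 := h _ h3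
        rw [map_sub, map_smul, hF y u, hy.2] at h4
        simpa using h4
      obtain ⟨w, hwE, hwo, hwn⟩ := (ih E' hE' hd').1
      refine ⟨Fin.cons u w, 0, rfl, ?_, ?_, ?_⟩
      · intro i
        refine Fin.cases hu (fun i => ((hmem _).mp (hwE i)).1) i
      · intro i j
        refine Fin.cases ?_ (fun i => ?_) i <;> refine Fin.cases ?_ (fun j => ?_) j
        · simp
        · intro _
          exact ((hmem _).mp (hwE j)).2
        · intro _
          simpa [hF] using ((hmem _).mp (hwE i)).2
        · intro hij
          exact hwo i j fun h => hij (by rw [h])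
      · intro i
        refine Fin.cases huu (fun i => hwn i) i
    refine ⟨?_, step⟩
    -- If every vector of `E` were isotropic, polarization would make the form vanish on `E`, so `E
    -- = 0` by nondegeneracy, against its positive dimension.
    by_contra hcon
    have hzero : ∀ u ∈ E, F u u = 0 := by
      intro u hu
      by_contra huu
      obtain ⟨w, _, _, h⟩ := step u hu huu
      exact hcon ⟨w, h⟩
    have hbot : E = ⊥ := by
      rw [Submodule.eq_bot_iff]
      refine fun u hu => hE u hu fun w hw => ?_
      have := hzero (u + w) (E.add_mem hu hw)
      simp only [map_add, LinearMap.add_apply, hzero u hu, hzero w hw, hF w u] at this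
      linarith
    rw [hbot] at hd
    simp at hd

/-! ### The characters of the rotation subgroup -/

section Characters

variable {n : ℕ} [NeZero n]

/-- `cos (2πj/n)`. -/
noncomputable def cs (j : ZMod n) : ℝ := (ZMod.stdAddChar j : ℂ).re

/-- `sin (2πj/n)`. -/
noncomputable def sn (j : ZMod n) : ℝ := (ZMod.stdAddChar j : ℂ).im

/-- The representation is defined through `j.val`, which is not additive. Passing to the additive
character of `ZMod n` makes the addition formulas hold modulo `n`. -/
theorem cos_eq_cs_and_sin_eq_sn (j : ZMod n) :
    Real.cos (2 * Real.pi * (j.val : ℝ) / (n : ℝ)) = cs j ∧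
      Real.sin (2 * Real.pi * (j.val : ℝ) / (n : ℝ)) = sn j := by
  have h : (ZMod.stdAddChar j : ℂ) =
      Complex.exp ((2 * Real.pi * (j.val : ℝ) / (n : ℝ) : ℝ) * Complex.I) := by
    rw [ZMod.stdAddChar_apply, ZMod.toCircle_apply]
    congr 1
    push_cast
    ring
  rw [cs, sn, h, Complex.exp_ofReal_mul_I_re, Complex.exp_ofReal_mul_I_im]
  exact ⟨rfl, rfl⟩

@[simp] theorem cs_zero : cs (0 : ZMod n) = 1 := by simp [cs]

@[simp] theorem sn_zero : sn (0 : ZMod n) = 0 := by simp [sn]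

theorem cs_add (i j : ZMod n) : cs (i + j) = cs i * cs j - sn i * sn j := by
  simp [cs, sn, AddChar.map_add_eq_mul]

theorem sn_add (i j : ZMod n) : sn (i + j) = sn i * cs j + cs i * sn j := by
  simp [cs, sn, AddChar.map_add_eq_mul, add_comm]

theorem cs_sq_add_sn_sq (j : ZMod n) : cs j ^ 2 + sn j ^ 2 = 1 := by
  obtain ⟨h1, h2⟩ := cos_eq_cs_and_sin_eq_sn j
  rw [← h1, ← h2, Real.cos_sq_add_sin_sq]

@[simp] theorem cs_neg (j : ZMod n) : cs (-j) = cs j := by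
  have h1 := cs_add j (-j)
  have h2 := sn_add j (-j)
  simp only [add_neg_cancel, cs_zero, sn_zero] at h1 h2
  linear_combination -cs j * h1 - sn j * h2 - cs (-j) * cs_sq_add_sn_sq j

@[simp] theorem sn_neg (j : ZMod n) : sn (-j) = -sn j := by
  have h1 := cs_add j (-j)
  have h2 := sn_add j (-j)
  simp only [add_neg_cancel, cs_zero, sn_zero] at h1 h2
  linear_combination sn j * h1 - cs j * h2 - sn (-j) * cs_sq_add_sn_sq j

theorem eq_zero_of_cs_eq_one {j : ZMod n} (h : cs j = 1) : j = 0 := by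
  have h1 := cs_sq_add_sn_sq j
  rw [h] at h1
  have h2 : sn j = 0 := by nlinarith
  apply ZMod.injective_stdAddChar
  rw [AddChar.map_zero_eq_one]
  exact Complex.ext h h2

theorem sum_cs_mul (k : ZMod n) : ∑ j : ZMod n, cs (k * j) = if k = 0 then (n : ℝ) else 0 := by
  have h := AddChar.sum_mulShift (ψ := (ZMod.stdAddChar : AddChar (ZMod n) ℂ)) k
    (ZMod.isPrimitive_stdAddChar n)
  have h1 := congrArg Complex.re h
  rw [Complex.re_sum] at h1
  simp only [cs, mul_comm k]
  rw [h1]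
  split <;> simp

end Characters

/-! ### The action on the plane -/

section Action

variable {n : ℕ} [NeZero n]

theorem act_r (j : ZMod n) (v : Plane) :
    act (DihedralGroup.r j) v = !₂[cs j * v 0 - sn j * v 1, sn j * v 0 + cs j * v 1] := by
  obtain ⟨h1, h2⟩ := cos_eq_cs_and_sin_eq_sn j
  ext i
  fin_cases i <;>
    simp [act, stdRep, rotMatrix, h1, h2, dotProduct, Fin.sum_univ_two, sub_eq_add_neg,
      -ZMod.natCast_val]

theorem act_sr (j : ZMod n) (v : Plane) :
    act (DihedralGroup.sr j) v = !₂[-(cs j * v 0 - sn j * v 1), sn j * v 0 + cs j * v 1] := by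
  obtain ⟨h1, h2⟩ := cos_eq_cs_and_sin_eq_sn j
  ext i
  fin_cases i <;>
    simp [act, stdRep, rotMatrix, h1, h2, dotProduct, Fin.sum_univ_two, sub_eq_add_neg,
      add_comm, -ZMod.natCast_val]

@[simp] theorem act_one (v : Plane) : act (1 : DihedralGroup n) v = v := by
  rw [DihedralGroup.one_def, act_r]
  ext i
  fin_cases i <;> simp

theorem act_mul (g h : DihedralGroup n) (v : Plane) : act (g * h) v = act g (act h v) := by
  rcases g with i | i <;> rcases h with j | j <;>
    simp only [DihedralGroup.r_mul_r, DihedralGroup.r_mul_sr, DihedralGroup.sr_mul_r,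
      DihedralGroup.sr_mul_sr, act_r, act_sr, sub_eq_add_neg, cs_add, sn_add, cs_neg, sn_neg] <;>
    ext k <;> fin_cases k <;> simp <;> ring

@[simp] theorem act_inv_act (g : DihedralGroup n) (v : Plane) : act g⁻¹ (act g v) = v := by
  rw [← act_mul, inv_mul_cancel, act_one]

@[simp] theorem act_act_inv (g : DihedralGroup n) (v : Plane) : act g (act g⁻¹ v) = v := by
  rw [← act_mul, mul_inv_cancel, act_one]

/-- The action of `g ∈ D_n` on the plane, as a linear isometry. -/
noncomputable def actIso (g : DihedralGroup n) : Plane ≃ₗᵢ[ℝ] Plane where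
  toFun := act g
  invFun := act g⁻¹
  left_inv := act_inv_act g
  right_inv := act_act_inv g
  map_add' u v := by
    ext i
    exact congrFun (Matrix.mulVec_add (stdRep n g) u v) i
  map_smul' t v := by
    ext i
    exact congrFun (Matrix.mulVec_smul (stdRep n g) t v) i
  norm_map' v := by
    change ‖act g v‖ = ‖v‖
    rw [EuclideanSpace.norm_eq, EuclideanSpace.norm_eq]
    congr 1
    rcases g with j | j <;> simp only [act_r, act_sr, Fin.sum_univ_two, Real.norm_eq_abs, sq_abs] <;>
      simp <;> linear_combination (v 0 ^ 2 + v 1 ^ 2) * cs_sq_add_sn_sq j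

@[simp] theorem actIso_apply (g : DihedralGroup n) (v : Plane) : actIso g v = act g v := rfl

theorem act_zero (g : DihedralGroup n) : act g (0 : Plane) = 0 := (actIso g).map_zero

theorem eq_zero_of_act_r_eq {j : ZMod n} {v : Plane} (hv : v ≠ 0)
    (h : act (DihedralGroup.r j) v = v) : j = 0 := by
  apply eq_zero_of_cs_eq_one
  rw [act_r] at h
  have h0 : cs j * v 0 - sn j * v 1 = v 0 := by simpa using congrArg (fun u : Plane => u 0) h
  have h1 : sn j * v 0 + cs j * v 1 = v 1 := by simpa using congrArg (fun u : Plane => u 1) h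
  have hne : v 0 ^ 2 + v 1 ^ 2 ≠ 0 := by
    intro h2
    apply hv
    have h3 : v 0 = 0 := by nlinarith [sq_nonneg (v 0), sq_nonneg (v 1)]
    have h4 : v 1 = 0 := by nlinarith [sq_nonneg (v 0), sq_nonneg (v 1)]
    ext i
    fin_cases i <;> simp [h3, h4]
  -- Pairing `r^j v = v` with `v` gives `cos · |v|² = |v|²`.
  have h5 : (cs j - 1) * (v 0 ^ 2 + v 1 ^ 2) = 0 := by linear_combination v 0 * h0 + v 1 * h1
  have := (mul_eq_zero.mp h5).resolve_right hne
  linarith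

theorem mem_orbit_self (v : Plane) : v ∈ orbit n v := ⟨1, act_one v⟩

theorem orbit_eq_of_mem {u v : Plane} (h : u ∈ orbit n v) : orbit n u = orbit n v := by
  obtain ⟨g, rfl⟩ := h
  ext w
  constructor
  · rintro ⟨k, rfl⟩
    exact ⟨k * g, act_mul k g v⟩
  · rintro ⟨k, rfl⟩
    exact ⟨k * g⁻¹, by simp [act_mul]⟩

theorem orbit_zero : orbit n (0 : Plane) = {0} := by
  ext w
  simp [orbit, act_zero]

theorem ncard_of_isRegularGon {S : Set Plane} (h : IsRegularGon n S) : S.ncard = n := by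
  obtain ⟨v, hv, rfl⟩ := h
  rw [← Set.image_univ, Set.ncard_image_of_injective, Set.ncard_univ, Nat.card_zmod]
  intro i j hij
  have h1 : act (DihedralGroup.r (-j + i)) v = v := by
    have := congrArg (act (DihedralGroup.r (-j))) hij
    simp only [← act_mul, DihedralGroup.r_mul_r] at this
    rw [this, neg_add_cancel, ← DihedralGroup.one_def, act_one]
  have := eq_zero_of_act_r_eq hv h1
  linear_combination this

theorem ncard_of_isSemiregularGon {S : Set Plane} (h : IsSemiregularGon n S) :
    S.ncard = 2 * n := by
  obtain ⟨v, hv, rfl⟩ := h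
  rw [orbit, ← Set.image_univ, Set.ncard_image_of_injective, Set.ncard_univ,
    DihedralGroup.nat_card]
  intro g k hgk
  by_contra hne
  refine hv (k⁻¹ * g) (fun h => hne ?_) ?_
  · rw [inv_mul_eq_one] at h
    exact h.symm
  · have := congrArg (act k⁻¹) hgk
    simpa [act_mul] using this

/-- A nonzero vector fixed by some `g ≠ 1` is fixed by a reflection, since nontrivial rotations fix
only the origin. Each reflection then acts on it like some rotation, so its `D_n`-orbit is already
its orbit under rotations. -/
theorem orbit_trichotomy (v : Plane) :
    orbit n v = {0} ∨ IsRegularGon n (orbit n v) ∨ IsSemiregularGon n (orbit n v) := by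
  rcases eq_or_ne v 0 with rfl | hv
  · exact Or.inl orbit_zero
  right
  by_cases h : ∀ g : DihedralGroup n, g ≠ 1 → act g v ≠ v
  · exact Or.inr ⟨v, h, rfl⟩
  left
  push Not at h
  obtain ⟨g, hg, hgv⟩ := h
  rcases g with j | j
  · exact absurd (by rw [eq_zero_of_act_r_eq hv hgv, DihedralGroup.one_def]) hg
  refine ⟨v, hv, Set.Subset.antisymm ?_ ?_⟩
  · rintro _ ⟨k, rfl⟩
    rcases k with i | i
    · exact ⟨i, rfl⟩
    · refine ⟨j - i, ?_⟩
      change _ = act (DihedralGroup.sr i) v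
      conv_rhs => rw [← hgv]
      rw [← act_mul, DihedralGroup.sr_mul_sr]
  · rintro _ ⟨i, rfl⟩
    exact ⟨DihedralGroup.r i, rfl⟩

end Action

/-! ### Counting points -/

/-- The points are counted along the fibres of `i ↦ orbit (x i)`. The three kinds of orbit have `1`,
`n` and `2n` points, which are distinct numbers, so no orbit is counted twice. -/
theorem IsRingSystem.count {n a b c N : ℕ} (hn : 2 < n) {x : Config N}
    (hx : Function.Injective fun i => x i)
    (hX : IsRingSystem n (Set.range fun i => x i) a b c) :
    (Finset.univ.filter fun i => x i = 0).card = a ∧ N = a + n * (b + 2 * c) ∧ 0 < b + 2 * c := by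
  classical
  have : NeZero n := ⟨by omega⟩
  let φ : Fin N → Set Plane := fun i => orbit n (x i)
  let O : Finset (Set Plane) := Finset.univ.image φ
  have hO (P : Set Plane → Prop) :
      {S | S ∈ orbit n '' (Set.range fun i => x i) ∧ P S}.ncard = (O.filter P).card := by
    rw [← Set.ncard_coe_finset]
    congr 1
    ext S
    simp [O, φ]
  have ha := hX.card_centre
  have hb := hX.card_regular
  have hc := hX.card_semiregular
  rw [hO] at ha hb hc
  have hzero : (Finset.univ.filter fun i => x i = 0).card = a := by
    rw [← ha, ← Finset.card_image_of_injOn (f := φ)]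
    · congr 1
      ext S
      simp only [Finset.mem_image, Finset.mem_filter, Finset.mem_univ, true_and, O, φ]
      constructor
      · rintro ⟨i, hi, rfl⟩
        exact ⟨⟨i, rfl⟩, by rw [hi, orbit_zero]⟩
      · rintro ⟨⟨i, rfl⟩, h⟩
        refine ⟨i, ?_, rfl⟩
        have := mem_orbit_self (n := n) (x i)
        rwa [h] at this
    · intro i hi j hj _
      simp only [Finset.coe_filter, Finset.mem_univ, true_and, Set.mem_ofPred_eq] at hi hj
      exact hx (hi.trans hj.symm)
  have hfib : ∀ S ∈ O, (Finset.univ.filter fun i => φ i = S).card =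
      (if S = {0} then 1 else 0) + (if IsRegularGon n S then n else 0) +
        (if IsSemiregularGon n S then 2 * n else 0) := by
    intro S hS
    obtain ⟨i₀, -, rfl⟩ := Finset.mem_image.mp hS
    have h1 : (Finset.univ.filter fun i => φ i = φ i₀).card = (φ i₀).ncard := by
      rw [← Set.ncard_coe_finset, ← Set.ncard_image_of_injective _ hx]
      congr 1
      ext w
      simp only [Finset.coe_filter, Finset.mem_univ, true_and, Set.mem_image, Set.mem_ofPred_eq]
      constructor
      · rintro ⟨i, hi, rfl⟩
        rw [← hi]
        exact mem_orbit_self _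
      · intro hw
        obtain ⟨g, rfl⟩ := id hw
        obtain ⟨i, hi⟩ := hX.symmetric g (x i₀) ⟨i₀, rfl⟩
        refine ⟨i, ?_, hi⟩
        change orbit n (x i) = _
        rw [show x i = act g (x i₀) from hi]
        exact orbit_eq_of_mem hw
    rw [h1]
    have c1 : φ i₀ = {0} → (φ i₀).ncard = 1 := fun h => by rw [h, Set.ncard_singleton]
    have c2 : IsRegularGon n (φ i₀) → (φ i₀).ncard = n := ncard_of_isRegularGon
    have c3 : IsSemiregularGon n (φ i₀) → (φ i₀).ncard = 2 * n := ncard_of_isSemiregularGon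
    have tri : φ i₀ = {0} ∨ IsRegularGon n (φ i₀) ∨ IsSemiregularGon n (φ i₀) :=
      orbit_trichotomy (x i₀)
    rcases tri with h | h | h
    · rw [if_pos h, if_neg fun h' => by have := c1 h; have := c2 h'; omega,
        if_neg fun h' => by have := c1 h; have := c3 h'; omega, c1 h]
    · rw [if_pos h, if_neg fun h' => by have := c1 h'; have := c2 h; omega,
        if_neg fun h' => by have := c2 h; have := c3 h'; omega, c2 h, zero_add, add_zero]
    · rw [if_pos h, if_neg fun h' => by have := c1 h'; have := c3 h; omega,
        if_neg fun h' => by have := c2 h'; have := c3 h; omega, c3 h, zero_add, zero_add]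
  have hN : N = a + n * (b + 2 * c) := by
    have h1 := Finset.card_eq_sum_card_image φ Finset.univ
    rw [Finset.card_univ, Fintype.card_fin, Finset.sum_congr rfl hfib, Finset.sum_add_distrib,
      Finset.sum_add_distrib, ← Finset.sum_filter, ← Finset.sum_filter, ← Finset.sum_filter,
      Finset.sum_const, Finset.sum_const, Finset.sum_const, hb, hc,
      show (O.filter fun S => S = {0}).card = a by convert ha] at h1
    simp only [smul_eq_mul] at h1
    rw [h1]
    ring
  refine ⟨hzero, hN, ?_⟩
  -- Without a gon all points would lie at the centre, but there are at least two.
  by_contra h0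
  have h1 : N = (Finset.univ.filter fun i => x i = 0).card := by
    rw [hzero, hN, show b + 2 * c = 0 by omega, mul_zero, add_zero]
  have h2 : ∀ i, x i = 0 := by
    intro i
    have h3 : (Finset.univ.filter fun i => x i = 0) = Finset.univ :=
      Finset.eq_univ_of_card _ (by rw [← h1, Fintype.card_fin])
    exact (Finset.mem_filter.mp (h3.symm ▸ Finset.mem_univ i :
      i ∈ Finset.univ.filter fun i => x i = 0)).2
  obtain ⟨u, ⟨i, rfl⟩, w, ⟨j, rfl⟩, hne⟩ := hX.nontrivial
  exact hne ((h2 i).trans (h2 j).symm)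

/-! ### The representation on displacements -/

/-- A linear isometry of the plane and a permutation of the points act on displacements. -/
noncomputable def transport {N : ℕ} (e : Plane ≃ₗᵢ[ℝ] Plane) (τ : Equiv.Perm (Fin N)) :
    Config N ≃ₗᵢ[ℝ] Config N :=
  (LinearIsometryEquiv.piLpCongrLeft 2 ℝ Plane τ).trans
    (LinearIsometryEquiv.piLpCongrRight 2 fun _ => e)

@[simp] theorem transport_apply {N : ℕ} (e : Plane ≃ₗᵢ[ℝ] Plane) (τ : Equiv.Perm (Fin N))
    (q : Config N) (i : Fin N) : transport e τ q i = e (q (τ.symm i)) := rfl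

@[simp] theorem J_apply {N : ℕ} (q : Config N) (i : Fin N) : J N q i = rotQuarter (q i) := rfl

@[simp] theorem diagOp_apply {N : ℕ} (w : Fin N → ℝ) (q : Config N) (i : Fin N) :
    diagOp w q i = w i • q i := rfl

theorem J_mul_J (N : ℕ) : J N * J N = -1 := by
  refine LinearMap.ext fun q => ?_
  ext i k
  fin_cases k <;> simp [rotQuarter]

theorem J_J {N : ℕ} (q : Config N) : J N (J N q) = -q := LinearMap.congr_fun (J_mul_J N) q

theorem J_mul_diagOp {N : ℕ} (w : Fin N → ℝ) : J N * diagOp w = diagOp w * J N := by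
  refine LinearMap.ext fun q => ?_
  ext1 i
  simp

theorem diagOp_mul_diagOp {N : ℕ} (w w' : Fin N → ℝ) (h : ∀ i, w i * w' i = 1) :
    diagOp w * diagOp w' = 1 := by
  refine LinearMap.ext fun q => ?_
  ext1 i
  simp [smul_smul, h]

/-- The mass inner product as a bilinear form. -/
noncomputable def massForm {N : ℕ} (m : Fin N → ℝ) : LinearMap.BilinForm ℝ (Config N) :=
  LinearMap.mk₂ ℝ (massInner m)
    (fun u v w => by simp [massInner, inner_add_left, mul_add, Finset.sum_add_distrib])
    (fun t u w => by
      simp only [massInner, PiLp.smul_apply, real_inner_smul_left, smul_eq_mul, Finset.mul_sum]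
      exact Finset.sum_congr rfl fun i _ => by ring)
    (fun u v w => by simp [massInner, inner_add_right, mul_add, Finset.sum_add_distrib])
    (fun t u w => by
      simp only [massInner, PiLp.smul_apply, real_inner_smul_right, smul_eq_mul, Finset.mul_sum]
      exact Finset.sum_congr rfl fun i _ => by ring)

@[simp] theorem massForm_apply {N : ℕ} (m : Fin N → ℝ) (u w : Config N) :
    massForm m u w = massInner m u w := rfl

theorem massInner_comm {N : ℕ} (m : Fin N → ℝ) (u w : Config N) :
    massInner m u w = massInner m w u := by
  simp [massInner, real_inner_comm]

theorem massInner_eq_inner {N : ℕ} (m : Fin N → ℝ) (u w : Config N) :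
    massInner m u w = inner ℝ u (diagOp m w) := by
  simp [massInner, PiLp.inner_apply, inner_smul_right]

theorem massInner_J_J {N : ℕ} (m : Fin N → ℝ) (u w : Config N) :
    massInner m (J N u) (J N w) = massInner m u w := by
  simp only [massInner, J_apply]
  refine Finset.sum_congr rfl fun i _ => ?_
  simp [rotQuarter, PiLp.inner_apply, Fin.sum_univ_two, add_comm]

theorem eq_zero_of_massInner_eq_zero {N : ℕ} {m : Fin N → ℝ} (hm : ∀ i, m i ≠ 0) {u : Config N}
    (h : ∀ w, massInner m u w = 0) : u = 0 := by
  have h1 := h (diagOp m⁻¹ u)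
  rw [massInner_eq_inner, ← Module.End.mul_apply, diagOp_mul_diagOp _ _ fun i => by simp [hm i]] at h1
  simpa using h1

/-- Since the points are distinct, the action on them lifts uniquely to an action on their labels,
and uniqueness makes the lift a homomorphism. -/
theorem exists_perm {n N : ℕ} [NeZero n] {x : Config N} (hx : Function.Injective fun i => x i)
    (hs : ∀ g : DihedralGroup n, ∀ v ∈ Set.range fun i => x i, act g v ∈ Set.range fun i => x i) :
    ∃ σ : DihedralGroup n →* Equiv.Perm (Fin N), ∀ g i, x (σ g i) = act g (x i) := by
  have h1 : ∀ (g : DihedralGroup n) (i : Fin N), ∃ j, x j = act g (x i) :=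
    fun g i => hs g _ ⟨i, rfl⟩
  choose f hf using h1
  have h2 : ∀ g k i, f (g * k) i = f g (f k i) := fun g k i => hx (by simp [hf, act_mul])
  have h3 : ∀ i, f 1 i = i := fun i => hx (by simp [hf])
  refine ⟨MonoidHom.toHomPerm ⟨⟨f, funext h3⟩, fun g k => funext (h2 g k)⟩, fun g i => ?_⟩
  exact hf g i

section Representation

variable {n N : ℕ} [NeZero n] (σ : DihedralGroup n →* Equiv.Perm (Fin N))

/-- The representation of `D_n` on displacements. -/
noncomputable def rep (g : DihedralGroup n) : Config N →ₗ[ℝ] Config N :=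
  (transport (actIso g) (σ g)).toLinearEquiv

theorem rep_apply (g : DihedralGroup n) (q : Config N) (i : Fin N) :
    rep σ g q i = act g (q (σ g⁻¹ i)) := by
  rw [map_inv]; rfl

theorem rep_one : rep σ 1 = 1 := by
  refine LinearMap.ext fun q => ?_
  ext1 i
  simp [rep_apply]

theorem rep_mul (g h : DihedralGroup n) : rep σ (g * h) = rep σ g * rep σ h := by
  refine LinearMap.ext fun q => ?_
  ext1 i
  simp [rep_apply, act_mul]

theorem J_mul_rep_r (j : ZMod n) :
    J N * rep σ (DihedralGroup.r j) = rep σ (DihedralGroup.r j) * J N := by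
  refine LinearMap.ext fun q => ?_
  ext i k
  fin_cases k <;> simp [rep_apply, act_r, rotQuarter] <;> ring

/-- Reflections reverse orientation; this sign is the source of the two halves of every block. -/
theorem J_mul_rep_sr (j : ZMod n) :
    J N * rep σ (DihedralGroup.sr j) = -(rep σ (DihedralGroup.sr j) * J N) := by
  refine LinearMap.ext fun q => ?_
  ext i k
  fin_cases k <;> (simp [rep_apply, act_sr, rotQuarter]; try ring)

/-- Needed in two roles: `x` is a fixed configuration, at which the Hessian is equivariant, and an
invariant displacement, hence in the trivial component. -/
theorem rep_self {x : Config N} (hσ : ∀ g i, x (σ g i) = act g (x i)) (g : DihedralGroup n) :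
    rep σ g x = x := by
  ext1 i
  rw [rep_apply, hσ, act_act_inv]

theorem massInner_rep {m : Fin N → ℝ} (hm : ∀ g i, m (σ g i) = m i) (g : DihedralGroup n)
    (u w : Config N) : massInner m (rep σ g u) w = massInner m u (rep σ g⁻¹ w) := by
  rw [massInner, massInner, ← Equiv.sum_comp (σ g)]
  refine Finset.sum_congr rfl fun i _ => ?_
  rw [hm, rep_apply, rep_apply, inv_inv, ← (actIso g).inner_map_map (u i)]
  simp

/-- Only points fixed by the rotation contribute, each with the trace `2 cos` of a planar rotation.
A nontrivial rotation fixes at most the centre; for `j = 0` all other points contribute `2` as well.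
-/
theorem trace_rep_r {x : Config N} (hx : Function.Injective fun i => x i)
    (hσ : ∀ g i, x (σ g i) = act g (x i)) (j : ZMod n) :
    LinearMap.trace ℝ (Config N) (rep σ (DihedralGroup.r j)) =
      2 * (Finset.univ.filter fun i => x i = 0).card * cs j +
        if j = 0 then 2 * ((N : ℝ) - (Finset.univ.filter fun i => x i = 0).card) else 0 := by
  classical
  have h1 : LinearMap.trace ℝ (Config N) (rep σ (DihedralGroup.r j)) =
      ∑ i : Fin N, if σ (DihedralGroup.r j)⁻¹ i = i then 2 * cs j else 0 := by
    rw [LinearMap.trace_eq_sum_inner _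
      (Pi.orthonormalBasis fun _ : Fin N => EuclideanSpace.basisFun (Fin 2) ℝ), Fintype.sum_sigma]
    refine Finset.sum_congr rfl fun i _ => ?_
    rw [Fin.sum_univ_two]
    simp only [Pi.orthonormalBasis_apply, PiLp.inner_apply, rep_apply]
    rw [DihedralGroup.inv_r]
    split_ifs with h
    · rw [Finset.sum_eq_single i, Finset.sum_eq_single i]
      · simp [h, act_r, two_mul]
      · intro k _ hk
        simp [hk]
      · simp
      · intro k _ hk
        simp [hk]
      · simp
    · rw [Finset.sum_eq_single i, Finset.sum_eq_single i]
      · simp [h, act_r]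
      · intro k _ hk
        simp [hk]
      · simp
      · intro k _ hk
        simp [hk]
      · simp
  rw [h1]
  have h2 (i : Fin N) : σ (DihedralGroup.r j)⁻¹ i = i ↔ j = 0 ∨ x i = 0 := by
    rw [← hx.eq_iff, hσ, DihedralGroup.inv_r]
    constructor
    · intro h
      by_contra! h3
      exact h3.1 (neg_eq_zero.mp (eq_zero_of_act_r_eq h3.2 h))
    · rintro (rfl | h)
      · rw [neg_zero, ← DihedralGroup.one_def, act_one]
      · rw [h, act_zero]
  simp only [h2]
  rcases eq_or_ne j 0 with rfl | hj
  · simp; ring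
  · simp only [hj, false_or, if_false, add_zero, ← Finset.sum_filter, Finset.sum_const, nsmul_eq_mul]
    ring

/-! ### Projections onto isotypic components -/

theorem sum_sn_mul (k : ZMod n) : ∑ j : ZMod n, sn (k * j) = 0 := by
  have h : ∑ j : ZMod n, sn (k * j) = ∑ j : ZMod n, sn (k * -j) :=
    (Equiv.sum_comp (Equiv.neg (ZMod n)) fun j => sn (k * j)).symm
  simp only [mul_neg, sn_neg, Finset.sum_neg_distrib] at h
  linarith

theorem sum_cs_add_mul (i k : ZMod n) :
    ∑ j : ZMod n, cs (i + k * j) = if k = 0 then (n : ℝ) * cs i else 0 := by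
  simp only [cs_add, Finset.sum_sub_distrib, ← Finset.mul_sum, sum_cs_mul, sum_sn_mul]
  split <;> simp [mul_comm]

theorem sum_cs_mul_cs (k l i : ZMod n) :
    ∑ j : ZMod n, cs (k * (i - j)) * cs (l * j) =
      n / 2 * cs (k * i) * ((if k = l then 1 else 0) + if k = -l then 1 else 0) := by
  have h (j : ZMod n) : cs (k * (i - j)) * cs (l * j) =
      1 / 2 * cs (k * i + (l - k) * j) + 1 / 2 * cs (k * i + -(l + k) * j) := by
    rw [show k * i + (l - k) * j = k * (i - j) + l * j by ring,
      show k * i + -(l + k) * j = k * (i - j) + -(l * j) by ring, cs_add, cs_add, cs_neg, sn_neg]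
    ring
  have h1 : l - k = 0 ↔ k = l := by rw [sub_eq_zero, eq_comm]
  have h2 : -(l + k) = 0 ↔ k = -l := by rw [neg_eq_zero, add_comm, add_eq_zero_iff_eq_neg]
  simp only [h, Finset.sum_add_distrib, ← Finset.mul_sum, sum_cs_add_mul, h1, h2]
  split_ifs <;> ring

/-- The normalization of the projection onto the `k`-th isotypic component. -/
noncomputable def isoCoeff (k : ZMod n) : ℝ := if k = -k then 1 else 2

/-- The projection onto the sum of the `k`-th and the `-k`-th isotypic components of the group of
rotations. -/
noncomputable def rotProj (k : ZMod n) : Config N →ₗ[ℝ] Config N :=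
  (isoCoeff k / n) • ∑ j : ZMod n, cs (k * j) • rep σ (DihedralGroup.r j)

theorem natCast_ne_zero_real : (n : ℝ) ≠ 0 := Nat.cast_ne_zero.mpr (NeZero.ne n)

/-- Convolution of cosines over `ZMod n`. Both indicators fire exactly when `k = l = -k`, which is
why `isoCoeff` is `1` for self-conjugate frequencies and `2` otherwise. -/
theorem rotProj_mul_rotProj (k l : ZMod n) : rotProj σ k * rotProj σ l =
    (isoCoeff l / 2 * ((if k = l then 1 else 0) + if k = -l then 1 else 0)) • rotProj σ k := by
  have h : (∑ i : ZMod n, cs (k * i) • rep σ (DihedralGroup.r i)) *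
      (∑ j : ZMod n, cs (l * j) • rep σ (DihedralGroup.r j)) =
      ((n : ℝ) / 2 * ((if k = l then 1 else 0) + if k = -l then 1 else 0)) •
        ∑ i : ZMod n, cs (k * i) • rep σ (DihedralGroup.r i) := by
    rw [Finset.mul_sum]
    have h1 (j : ZMod n) : (∑ i : ZMod n, cs (k * i) • rep σ (DihedralGroup.r i)) *
        (cs (l * j) • rep σ (DihedralGroup.r j)) =
        ∑ i : ZMod n, (cs (k * (i - j)) * cs (l * j)) • rep σ (DihedralGroup.r i) := by
      rw [Finset.sum_mul, ← Equiv.sum_comp (Equiv.addRight j)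
        fun i => (cs (k * (i - j)) * cs (l * j)) • rep σ (DihedralGroup.r i)]
      refine Finset.sum_congr rfl fun i _ => ?_
      simp only [Equiv.coe_addRight, add_sub_cancel_right]
      rw [smul_mul_smul_comm, ← rep_mul,
        DihedralGroup.r_mul_r]
    rw [Finset.sum_congr rfl fun j _ => h1 j, Finset.sum_comm, Finset.smul_sum]
    refine Finset.sum_congr rfl fun i _ => ?_
    rw [← Finset.sum_smul, sum_cs_mul_cs, smul_smul]
    congr 1
    ring
  rw [rotProj, rotProj, smul_mul_smul_comm, h, smul_smul, smul_smul]
  congr 1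
  have := natCast_ne_zero_real (n := n)
  field_simp

theorem rotProj_mul_self (k : ZMod n) : rotProj σ k * rotProj σ k = rotProj σ k := by
  have h : (if k = k then (1 : ℝ) else 0) = 1 := if_pos rfl
  rw [rotProj_mul_rotProj, isoCoeff, h]
  split_ifs <;> norm_num

theorem rotProj_mul_of_ne {k l : ZMod n} (h1 : k ≠ l) (h2 : k ≠ -l) :
    rotProj σ k * rotProj σ l = 0 := by
  simp [rotProj_mul_rotProj, h1, h2]

theorem mul_rotProj {T : Config N →ₗ[ℝ] Config N}
    (hT : ∀ j, T * rep σ (DihedralGroup.r j) = rep σ (DihedralGroup.r j) * T) (k : ZMod n) :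
    T * rotProj σ k = rotProj σ k * T := by
  simp only [rotProj, mul_smul_comm, smul_mul_assoc, Finset.mul_sum, Finset.sum_mul, hT]

/-- Conjugation by `s` inverts rotations, and the cosine is even. This is the reason for grouping
the frequencies `k` and `-k`. -/
theorem rep_sr_mul_rotProj (k : ZMod n) : rep σ (DihedralGroup.sr 0) * rotProj σ k =
    rotProj σ k * rep σ (DihedralGroup.sr 0) := by
  simp only [rotProj, mul_smul_comm, smul_mul_assoc, Finset.mul_sum, Finset.sum_mul, ← rep_mul,
    DihedralGroup.sr_mul_r, DihedralGroup.r_mul_sr, zero_add, zero_sub]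
  rw [← Equiv.sum_comp (Equiv.neg (ZMod n))]
  simp

theorem rep_sr_mul_self : rep σ (DihedralGroup.sr 0) * rep σ (DihedralGroup.sr 0) = 1 := by
  rw [← rep_mul, DihedralGroup.sr_mul_self, rep_one]

/-- The projection onto the displacements in the image of `rotProj σ k` on which the reflection `s`
acts as the sign `ε`. -/
noncomputable def isoProj (k : ZMod n) (ε : ℤˣ) : Config N →ₗ[ℝ] Config N :=
  rotProj σ k * ((1 / 2 : ℝ) • (1 + ((ε : ℤ) : ℝ) • rep σ (DihedralGroup.sr 0)))

theorem signProj_mul (ε δ : ℤˣ) :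
    ((1 / 2 : ℝ) • (1 + ((ε : ℤ) : ℝ) • rep σ (DihedralGroup.sr 0))) *
      ((1 / 2 : ℝ) • (1 + ((δ : ℤ) : ℝ) • rep σ (DihedralGroup.sr 0))) =
    if ε = δ then (1 / 2 : ℝ) • (1 + ((ε : ℤ) : ℝ) • rep σ (DihedralGroup.sr 0)) else 0 := by
  simp only [add_mul, mul_add, one_mul, mul_one, mul_smul_comm, smul_mul_assoc,
    rep_sr_mul_self]
  rcases Int.units_eq_one_or ε with rfl | rfl <;> rcases Int.units_eq_one_or δ with rfl | rfl <;>
    simp <;> module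

theorem isoProj_mul_isoProj (k l : ZMod n) (ε δ : ℤˣ) : isoProj σ k ε * isoProj σ l δ =
    rotProj σ k * rotProj σ l * (((1 / 2 : ℝ) • (1 + ((ε : ℤ) : ℝ) • rep σ (DihedralGroup.sr 0))) *
      ((1 / 2 : ℝ) • (1 + ((δ : ℤ) : ℝ) • rep σ (DihedralGroup.sr 0)))) := by
  have h : ((1 / 2 : ℝ) • (1 + ((ε : ℤ) : ℝ) • rep σ (DihedralGroup.sr 0))) * rotProj σ l =
      rotProj σ l * ((1 / 2 : ℝ) • (1 + ((ε : ℤ) : ℝ) • rep σ (DihedralGroup.sr 0))) := by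
    simp only [smul_mul_assoc, mul_smul_comm, add_mul, mul_add, rep_sr_mul_rotProj, one_mul, mul_one]
  rw [isoProj, isoProj, mul_assoc, ← mul_assoc _ (rotProj σ l), h]
  simp only [mul_assoc]

theorem isoProj_mul_self (k : ZMod n) (ε : ℤˣ) :
    isoProj σ k ε * isoProj σ k ε = isoProj σ k ε := by
  rw [isoProj_mul_isoProj, rotProj_mul_self, signProj_mul, if_pos rfl, isoProj]

theorem isoProj_mul_of_ne {k l : ZMod n} {ε δ : ℤˣ} (h : (k ≠ l ∧ k ≠ -l) ∨ ε ≠ δ) :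
    isoProj σ k ε * isoProj σ l δ = 0 := by
  rw [isoProj_mul_isoProj, signProj_mul]
  rcases h with ⟨h1, h2⟩ | h
  · rw [rotProj_mul_of_ne σ h1 h2, zero_mul]
  · rw [if_neg h, mul_zero]

theorem mul_isoProj {T : Config N →ₗ[ℝ] Config N} (hT : ∀ g, T * rep σ g = rep σ g * T)
    (k : ZMod n) (ε : ℤˣ) : T * isoProj σ k ε = isoProj σ k ε * T := by
  rw [isoProj, ← mul_assoc, mul_rotProj σ fun j => hT _, mul_assoc, mul_assoc]
  simp only [mul_smul_comm, smul_mul_assoc, mul_add, add_mul, hT, mul_one, one_mul]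

/-- Commuting with rotations preserves the frequency; anticommuting with `s` flips the sign. -/
theorem J_mul_isoProj (k : ZMod n) (ε : ℤˣ) :
    J N * isoProj σ k ε = isoProj σ k (-ε) * J N := by
  rw [isoProj, isoProj, ← mul_assoc, mul_rotProj σ (J_mul_rep_r σ), mul_assoc, mul_assoc]
  simp only [mul_smul_comm, smul_mul_assoc, mul_add, add_mul, J_mul_rep_sr, mul_one, one_mul,
    Units.val_neg, Int.cast_neg, neg_smul, smul_neg, neg_mul, mul_neg]

/-- The adjoint of `g` is `g⁻¹` because the masses are constant on orbits. The coefficients of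
`rotProj` are even and `s` is an involution, so both factors are self-adjoint, and they commute. -/
theorem massInner_isoProj {m : Fin N → ℝ} (hm : ∀ g i, m (σ g i) = m i) (k : ZMod n) (ε : ℤˣ)
    (u w : Config N) : massInner m (isoProj σ k ε u) w = massInner m u (isoProj σ k ε w) := by
  have h1 (u w : Config N) : massForm m (rotProj σ k u) w = massForm m u (rotProj σ k w) := by
    simp only [rotProj, LinearMap.smul_apply, LinearMap.sum_apply, map_smul, map_sum,
      massForm_apply, massInner_rep σ hm, DihedralGroup.inv_r]
    rw [← Equiv.sum_comp (Equiv.neg (ZMod n))]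
    simp
  have h2 (u w : Config N) :
      massForm m (((1 / 2 : ℝ) • (1 + ((ε : ℤ) : ℝ) • rep σ (DihedralGroup.sr 0))) u) w =
        massForm m u (((1 / 2 : ℝ) • (1 + ((ε : ℤ) : ℝ) • rep σ (DihedralGroup.sr 0))) w) := by
    simp only [LinearMap.smul_apply, LinearMap.add_apply, map_smul, map_add, massForm_apply,
      massInner_rep σ hm, DihedralGroup.inv_sr, Module.End.one_apply]
  have h3 : isoProj σ k ε =
      ((1 / 2 : ℝ) • (1 + ((ε : ℤ) : ℝ) • rep σ (DihedralGroup.sr 0))) * rotProj σ k := by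
    simp only [isoProj, smul_mul_assoc, mul_smul_comm, add_mul, mul_add, rep_sr_mul_rotProj,
      one_mul, mul_one]
  conv_rhs => rw [h3]
  rw [isoProj, ← massForm_apply, ← massForm_apply, Module.End.mul_apply, Module.End.mul_apply,
    h1, h2]

/-- The reflection term has trace zero, so the two signs get equal dimensions and the points on
mirror lines need not be counted. -/
theorem trace_isoProj {x : Config N} (hx : Function.Injective fun i => x i)
    (hσ : ∀ g i, x (σ g i) = act g (x i)) (k : ZMod n) (ε : ℤˣ) :
    LinearMap.trace ℝ (Config N) (isoProj σ k ε) = isoCoeff k / n *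
      ((Finset.univ.filter fun i => x i = 0).card * (n / 2) *
          ((if k = 1 then 1 else 0) + if k = -1 then 1 else 0) +
        ((N : ℝ) - (Finset.univ.filter fun i => x i = 0).card)) := by
  set a : ℝ := ((Finset.univ.filter fun i => x i = 0).card : ℝ) with ha
  have h1 : LinearMap.trace ℝ (Config N) (rotProj σ k) = isoCoeff k / n *
      (2 * a * (n / 2) * ((if k = 1 then 1 else 0) + if k = -1 then 1 else 0) +
        2 * ((N : ℝ) - a)) := by
    rw [rotProj, map_smul, map_sum, smul_eq_mul]
    simp only [map_smul, trace_rep_r σ hx hσ, smul_eq_mul, mul_add, ← ha]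
    rw [Finset.sum_add_distrib]
    have h2 := sum_cs_mul_cs k 1 (0 : ZMod n)
    simp only [zero_sub, mul_neg, cs_neg, one_mul, mul_zero, cs_zero, mul_one] at h2
    have h3 : ∑ j : ZMod n, cs (k * j) * (2 * a * cs j) =
        2 * a * ∑ j : ZMod n, cs (k * j) * cs j := by
      rw [Finset.mul_sum]
      exact Finset.sum_congr rfl fun j _ => by ring
    have h4 : ∑ j : ZMod n, cs (k * j) * (if j = 0 then 2 * ((N : ℝ) - a) else 0) =
        2 * ((N : ℝ) - a) := by simp
    rw [h3, h2, h4]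
    ring
  have h2 : LinearMap.trace ℝ (Config N) (rotProj σ k * rep σ (DihedralGroup.sr 0)) = 0 := by
    set T := rotProj σ k * rep σ (DihedralGroup.sr 0) with hT
    have h3 : J N * T = -(T * J N) := by
      rw [hT, ← mul_assoc, mul_rotProj σ (J_mul_rep_r σ), mul_assoc, J_mul_rep_sr, mul_neg,
        mul_assoc]
    -- The left product equals `T` by anticommutation and the right one equals `-T`, so cyclicity
    -- gives `tr T = -tr T`.
    have h4 : LinearMap.trace ℝ (Config N) (J N * (T * J N)) =
        LinearMap.trace ℝ (Config N) (T * J N * J N) := LinearMap.trace_mul_comm _ _ _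
    rw [← mul_assoc, h3, neg_mul, mul_assoc, J_mul_J] at h4
    simp only [mul_neg, mul_one, neg_neg, map_neg] at h4
    linarith
  have h3 : isoProj σ k ε = (1 / 2 : ℝ) • rotProj σ k +
      (((ε : ℤ) : ℝ) / 2) • (rotProj σ k * rep σ (DihedralGroup.sr 0)) := by
    simp only [isoProj, mul_smul_comm, mul_add, mul_one]
    module
  rw [h3, map_add, map_smul, map_smul, h1, h2]
  simp only [smul_eq_mul]
  ring

/-- The displacements in the `±k`-th isotypic components of the group of rotations on which the
reflection `s` acts as the sign `ε`. -/
noncomputable def isoSpace (k : ZMod n) (ε : ℤˣ) : Submodule ℝ (Config N) :=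
  LinearMap.range (isoProj σ k ε)

theorem mem_isoSpace {k : ZMod n} {ε : ℤˣ} {u : Config N} :
    u ∈ isoSpace σ k ε ↔ isoProj σ k ε u = u := by
  constructor
  · rintro ⟨w, rfl⟩
    exact LinearMap.congr_fun (isoProj_mul_self σ k ε) w
  · intro h
    exact ⟨u, h⟩

theorem finrank_isoSpace {x : Config N} (hx : Function.Injective fun i => x i)
    (hσ : ∀ g i, x (σ g i) = act g (x i)) (k : ZMod n) (ε : ℤˣ) :
    (Module.finrank ℝ (isoSpace σ k ε) : ℝ) = isoCoeff k / n *
      ((Finset.univ.filter fun i => x i = 0).card * (n / 2) *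
          ((if k = 1 then 1 else 0) + if k = -1 then 1 else 0) +
        ((N : ℝ) - (Finset.univ.filter fun i => x i = 0).card)) := by
  rw [← trace_isoProj σ hx hσ k ε]
  have h : LinearMap.IsProj (isoSpace σ k ε) (isoProj σ k ε) :=
    ⟨fun w => ⟨w, rfl⟩, fun w hw => (mem_isoSpace σ).mp hw⟩
  exact h.trace.symm

theorem map_mem_isoSpace {T : Config N →ₗ[ℝ] Config N} (hT : ∀ g, T * rep σ g = rep σ g * T)
    {k : ZMod n} {ε : ℤˣ} {u : Config N} (hu : u ∈ isoSpace σ k ε) : T u ∈ isoSpace σ k ε := by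
  rw [mem_isoSpace] at hu ⊢
  rw [← Module.End.mul_apply, ← mul_isoProj σ hT, Module.End.mul_apply, hu]

theorem J_mem_isoSpace {k : ZMod n} {ε : ℤˣ} {u : Config N} (hu : u ∈ isoSpace σ k ε) :
    J N u ∈ isoSpace σ k (-ε) := by
  rw [mem_isoSpace] at hu ⊢
  rw [← Module.End.mul_apply, ← J_mul_isoProj σ, Module.End.mul_apply, hu]

theorem massInner_eq_zero_of_mem_isoSpace {m : Fin N → ℝ} (hm : ∀ g i, m (σ g i) = m i)
    {k l : ZMod n} {ε δ : ℤˣ} (h : (k ≠ l ∧ k ≠ -l) ∨ ε ≠ δ) {u w : Config N}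
    (hu : u ∈ isoSpace σ k ε) (hw : w ∈ isoSpace σ l δ) : massInner m u w = 0 := by
  rw [mem_isoSpace] at hu hw
  rw [← hu, ← hw, massInner_isoProj σ hm, ← Module.End.mul_apply, isoProj_mul_of_ne σ h,
    LinearMap.zero_apply, ← massForm_apply, map_zero]

theorem eq_zero_of_mem_isoSpace {m : Fin N → ℝ} (hm : ∀ g i, m (σ g i) = m i)
    (hm0 : ∀ i, m i ≠ 0) {k : ZMod n} {ε : ℤˣ} {u : Config N} (hu : u ∈ isoSpace σ k ε)
    (h : ∀ w ∈ isoSpace σ k ε, massInner m u w = 0) : u = 0 := by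
  refine eq_zero_of_massInner_eq_zero hm0 fun w => ?_
  rw [mem_isoSpace] at hu
  rw [← hu, massInner_isoProj σ hm]
  exact h _ ⟨w, rfl⟩

/-! ### The distinguished displacements -/

theorem mem_isoSpace_of_rep_eq {u : Config N} (hu : ∀ g, rep σ g u = u) : u ∈ isoSpace σ 0 1 := by
  rw [mem_isoSpace, isoProj, rotProj]
  have := natCast_ne_zero_real (n := n)
  have h1 : (2⁻¹ : ℝ) • u + (2⁻¹ : ℝ) • u = u := by module
  simp [hu, isoCoeff, h1, smul_smul, ← Nat.cast_smul_eq_nsmul ℝ, this]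

theorem J_transH (N : ℕ) : J N (transH N) = transV N := by
  ext i k
  fin_cases k <;> simp [transH, transV, rotQuarter]

theorem J_transV (N : ℕ) : J N (transV N) = -transH N := by
  rw [← J_transH, J_J]

/-- The translations span a copy of the standard representation, in which `s` fixes the vertical
one. In the average `∑ cos · sin` vanishes by parity and `∑ cos² = n/2`, where `n > 2` ensures `1 ≠
-1`. -/
theorem transV_mem_isoSpace (hn : 2 < n) : transV N ∈ isoSpace σ 1 1 := by
  have h1 (j : ZMod n) : rep σ (DihedralGroup.r j) (transV N) =
      cs j • transV N - sn j • transH N := by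
    ext i k
    fin_cases k <;> simp [transV, transH, rep_apply, act_r]
  have h2 : rep σ (DihedralGroup.sr (0 : ZMod n)) (transV N) = transV N := by
    ext i k
    fin_cases k <;> simp [transV, rep_apply, act_sr]
  have h3 : (1 / 2 : ℝ) • (transV N + transV N) = transV N := by module
  have h4 : (1 : ZMod n) ≠ -1 := by
    intro h
    have h5 : ((2 : ℕ) : ZMod n) = 0 := by
      push_cast
      linear_combination h
    rw [ZMod.natCast_eq_zero_iff] at h5
    exact absurd (Nat.le_of_dvd (by norm_num) h5) (by omega)
  have h6 := sum_cs_mul_cs (1 : ZMod n) 1 0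
  simp only [zero_sub, one_mul, cs_neg, mul_zero, cs_zero, mul_one, if_true, h4, if_false,
    add_zero] at h6
  have h7 : ∑ j : ZMod n, cs j * sn j = 0 := by
    have h : ∑ j : ZMod n, cs j * sn j = ∑ j : ZMod n, cs (-j) * sn (-j) :=
      (Equiv.sum_comp (Equiv.neg (ZMod n)) fun j => cs j * sn j).symm
    simp only [sn_neg, cs_neg, mul_neg, Finset.sum_neg_distrib] at h
    linarith
  have := natCast_ne_zero_real (n := n)
  rw [mem_isoSpace, isoProj, rotProj]
  simp only [Units.val_one, Int.cast_one, one_smul, Module.End.mul_apply, LinearMap.smul_apply,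
    LinearMap.add_apply, Module.End.one_apply, h2, h3, LinearMap.sum_apply, one_mul, h1, smul_sub,
    smul_smul, Finset.sum_sub_distrib, ← Finset.sum_smul, h6, h7, zero_smul, sub_zero, isoCoeff, h4,
    if_false]
  rw [show (2 : ℝ) / n * (n / 2) = 1 by field_simp, one_smul]

end Representation

/-! ### Gradients of invariant functions -/

section Gradients

open scoped Topology

variable {E : Type*} [NormedAddCommGroup E] [InnerProductSpace ℝ E] [CompleteSpace E] {F : E → ℝ}

theorem inner_gradient (F : E → ℝ) (q u : E) :
    inner ℝ (gradient F q) u = fderiv ℝ F q u := by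
  rw [gradient, InnerProductSpace.toDual_symm_apply]

theorem gradient_map_of_invariant (e : E ≃ₗᵢ[ℝ] E) (he : ∀ q, F (e q) = F q)
    (q : E) : gradient F (e q) = e (gradient F q) := by
  have h1 : F ∘ e = F := funext he
  refine ext_inner_right ℝ fun u => ?_
  have h2 : fderiv ℝ F q (e.symm u) = fderiv ℝ F (e q) u := by
    have h3 := e.toContinuousLinearEquiv.comp_right_fderiv (f := F) (x := q)
    have h4 : F ∘ e.toContinuousLinearEquiv = F := h1
    rw [h4] at h3
    rw [h3]
    simp
  rw [inner_gradient, ← h2, ← inner_gradient, ← e.inner_map_map]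
  simp

/-- The chain rule for `∇F ∘ e = e ∘ ∇F` at a fixed point. Composition with an isomorphism needs no
differentiability on either side. -/
theorem fderiv_gradient_comp_of_invariant (e : E ≃ₗᵢ[ℝ] E) (he : ∀ q, F (e q) = F q)
    {x : E} (hx : e x = x) (u : E) : fderiv ℝ (gradient F) x (e u) = e (fderiv ℝ (gradient F) x u) := by
  have h1 : gradient F ∘ e.toContinuousLinearEquiv = e.toContinuousLinearEquiv ∘ gradient F :=
    funext (gradient_map_of_invariant e he)
  have h2 := e.toContinuousLinearEquiv.comp_right_fderiv (f := gradient F) (x := x)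
  rw [h1, ContinuousLinearEquiv.comp_fderiv] at h2
  have h3 := congrArg (fun T : E →L[ℝ] E => T u) h2
  have h4 : e.toContinuousLinearEquiv x = x := hx
  rw [h4] at h3
  exact h3.symm

theorem fderiv_gradient_eq_zero_of_invariant {δ : E} (h : ∀ (q : E) (t : ℝ), F (q + t • δ) = F q)
    (x : E) : fderiv ℝ (gradient F) x δ = 0 := by
  by_cases hd : DifferentiableAt ℝ (gradient F) x
  · have h1 (t : ℝ) : gradient F (x + t • δ) = gradient F x := by
      rw [gradient, gradient, ← fderiv_comp_add_right]
      simp only [h]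
    have h2 : HasDerivAt (fun t : ℝ => x + t • δ) δ 0 := by
      simpa using ((hasDerivAt_id (0 : ℝ)).smul_const δ).const_add x
    have h3 : HasFDerivAt (gradient F) (fderiv ℝ (gradient F) x) (x + (0 : ℝ) • δ) := by
      simpa using hd.hasFDerivAt
    have h4 := h3.comp_hasDerivAt (0 : ℝ) h2
    have h5 : (gradient F ∘ fun t : ℝ => x + t • δ) = fun _ => gradient F x := funext h1
    rw [h5] at h4
    exact h4.unique (hasDerivAt_const _ _)
  -- Here the derivative has its default value `0`.
  · rw [fderiv_zero_of_not_differentiableAt hd]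
    rfl

theorem differentiableAt_gradient {x : E} (hF : ContDiffAt ℝ 2 F x) :
    DifferentiableAt ℝ (gradient F) x := by
  have h1 : ContDiffAt ℝ 1 (fderiv ℝ F) x := hF.fderiv_right (by norm_num)
  exact ((InnerProductSpace.toDual ℝ (E)).symm.toContinuousLinearEquiv.differentiableAt).comp
    x (h1.differentiableAt (by norm_num))

theorem inner_fderiv_gradient {x : E} (hF : ContDiffAt ℝ 2 F x) (u w : E) :
    inner ℝ (fderiv ℝ (gradient F) x u) w = fderiv ℝ (fderiv ℝ F) x u w := by
  have h1 : ContDiffAt ℝ 1 (fderiv ℝ F) x := hF.fderiv_right (by norm_num)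
  have h2 : gradient F =
      (InnerProductSpace.toDual ℝ (E)).symm.toContinuousLinearEquiv ∘ fderiv ℝ F := rfl
  rw [h2, ContinuousLinearEquiv.comp_fderiv]
  exact InnerProductSpace.toDual_symm_apply

theorem inner_fderiv_gradient_comm {x : E} (hF : ContDiffAt ℝ 2 F x) (u w : E) :
    inner ℝ (fderiv ℝ (gradient F) x u) w = inner ℝ u (fderiv ℝ (gradient F) x w) := by
  rw [inner_fderiv_gradient hF, real_inner_comm, inner_fderiv_gradient hF]
  exact hF.isSymmSndFDerivAt (by simp) u w

/-- Differentiate `∇F(e_t x) = e_t ∇F(x)` at `t = 0`. -/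
theorem fderiv_gradient_apply_rotation {x : E} (hF : ContDiffAt ℝ 2 F x) (T : E →ₗ[ℝ] E)
    (e : ℝ → E ≃ₗᵢ[ℝ] E)
    (he : ∀ t q, F (e t q) = F q)
    (heJ : ∀ t q, e t q = Real.cos t • q + Real.sin t • T q) :
    fderiv ℝ (gradient F) x (T x) = T (gradient F x) := by
  have key (q : E) : HasDerivAt (fun t => e t q) (T q) 0 := by
    have h1 := ((Real.hasDerivAt_cos 0).smul_const q).fun_add
      ((Real.hasDerivAt_sin 0).smul_const (T q))
    simp only [heJ]
    simpa using h1
  have h0 : e 0 x = x := by simp [heJ]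
  have h1 : HasFDerivAt (gradient F) (fderiv ℝ (gradient F) x) (e 0 x) := by
    rw [h0]
    exact (differentiableAt_gradient hF).hasFDerivAt
  have h2 := h1.comp_hasDerivAt (0 : ℝ) (key x)
  have h3 : (gradient F ∘ fun t => e t x) = fun t => e t (gradient F x) :=
    funext fun t => gradient_map_of_invariant (e t) (he t) x
  rw [h3] at h2
  exact h2.unique (key _)

/-- Euler's identity for the gradient, which is homogeneous of degree `p - 1`. The constant `c t`
admits the logarithm, with `p = 0`; homogeneity is asked only near `x`, away from collisions. -/
theorem fderiv_gradient_apply_self {x : E} (hF : ContDiffAt ℝ 2 F x) (p : ℝ) (c : ℝ → ℝ)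
    (h : ∀ t : ℝ, 0 < t → ∀ᶠ q in 𝓝 x, F (t • q) = t ^ p * F q + c t) :
    fderiv ℝ (gradient F) x x = (p - 1) • gradient F x := by
  have hd : DifferentiableAt ℝ F x := hF.differentiableAt (by norm_num)
  have h1 (t : ℝ) (ht : 0 < t) : gradient F (t • x) = t ^ (p - 1) • gradient F x := by
    refine ext_inner_right ℝ fun u => ?_
    have h2 : fderiv ℝ (fun q => F (t • q)) x = fderiv ℝ (fun q => t ^ p * F q + c t) x :=
      Filter.EventuallyEq.fderiv_eq (h t ht)
    rw [fderiv_comp_smul, fderiv_add_const, fderiv_const_mul hd] at h2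
    have h3 := congrArg (fun T : E →L[ℝ] ℝ => T u) h2
    simp only [smul_apply, smul_eq_mul] at h3
    rw [real_inner_smul_left, inner_gradient, inner_gradient, Real.rpow_sub_one ht.ne']
    field_simp
    linarith
  have h2 : HasFDerivAt (gradient F) (fderiv ℝ (gradient F) x) ((1 : ℝ) • x) := by
    rw [one_smul]
    exact (differentiableAt_gradient hF).hasFDerivAt
  have h3 := h2.comp_hasDerivAt (1 : ℝ) ((hasDerivAt_id (1 : ℝ)).smul_const x)
  have h4 : HasDerivAt (fun t : ℝ => t ^ (p - 1) • gradient F x) ((p - 1) • gradient F x) 1 := by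
    have := (Real.hasDerivAt_rpow_const (x := 1) (p := p - 1) (Or.inl one_ne_zero)).smul_const
      (gradient F x)
    simpa using this
  have h5 : (gradient F ∘ fun t : ℝ => id t • x) =ᶠ[𝓝 1] fun t => t ^ (p - 1) • gradient F x := by
    filter_upwards [lt_mem_nhds (zero_lt_one' ℝ)] with t ht
    exact h1 t ht
  have h6 := (h3.congr_of_eventuallyEq h5.symm).unique h4
  simpa using h6

end Gradients

theorem hess_apply {N : ℕ} (F : Config N → ℝ) (x u : Config N) :
    hess F x u = fderiv ℝ (gradient F) x u := rfl

/-! ### Pair energies -/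

/-- The energy `∑_{i<j} mᵢ mⱼ φ(‖qᵢ - qⱼ‖)`. -/
noncomputable def pairEnergy {N : ℕ} (φ : ℝ → ℝ) (m : Fin N → ℝ) (q : Config N) : ℝ :=
  ∑ i, ∑ j ∈ Finset.Ioi i, m i * m j * φ ‖q i - q j‖

theorem potential_eq_pairEnergy {N : ℕ} (γ : ℝ) (m : Fin N → ℝ) :
    potential γ m = pairEnergy (fun t => 1 / (2 * γ + 2) * t ^ (2 * γ + 2)) m := by
  funext q
  simp only [potential, pairEnergy, Finset.mul_sum]
  exact Finset.sum_congr rfl fun i _ => Finset.sum_congr rfl fun j _ => by ring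

theorem vortexH_eq_pairEnergy {N : ℕ} (m : Fin N → ℝ) :
    vortexH m = pairEnergy (fun t => -Real.log t) m := by
  funext q
  simp only [vortexH, pairEnergy, mul_neg, Finset.sum_neg_distrib]

section PairEnergy

variable {N : ℕ} (φ : ℝ → ℝ) (m : Fin N → ℝ)

/-- A permutation of the labels does not respect `i < j`; the sum over ordered pairs is visibly
invariant. -/
theorem two_mul_pairEnergy (q : Config N) :
    2 * pairEnergy φ m q = ∑ i, ∑ j, if j = i then 0 else m j * m i * φ ‖q j - q i‖ := by
  classical
  have h := Finset.sum_sum_Ioi_add_eq_sum_sum_off_diag fun i j => m i * m j * φ ‖q i - q j‖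
  have h1 (i j : Fin N) : m j * m i * φ ‖q j - q i‖ + m i * m j * φ ‖q i - q j‖ =
      2 * (m i * m j * φ ‖q i - q j‖) := by
    rw [norm_sub_rev]; ring
  simp only [h1, ← Finset.mul_sum] at h
  rw [pairEnergy, h]
  refine Finset.sum_congr rfl fun i _ => ?_
  rw [← Finset.sum_filter_add_sum_filter_not Finset.univ (fun j => j = i)]
  rw [Finset.sum_eq_zero fun j hj => if_pos (Finset.mem_filter.mp hj).2, zero_add]
  refine Finset.sum_congr (by ext; simp) fun j hj => ?_
  rw [if_neg (by simpa using hj)]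

theorem pairEnergy_transport (e : Plane ≃ₗᵢ[ℝ] Plane) (τ : Equiv.Perm (Fin N))
    (hm : ∀ i, m (τ i) = m i) (q : Config N) :
    pairEnergy φ m (transport e τ q) = pairEnergy φ m q := by
  have h : 2 * pairEnergy φ m (transport e τ q) = 2 * pairEnergy φ m q := by
    rw [two_mul_pairEnergy, two_mul_pairEnergy, ← Equiv.sum_comp τ]
    refine Finset.sum_congr rfl fun i _ => ?_
    rw [← Equiv.sum_comp τ]
    refine Finset.sum_congr rfl fun j _ => ?_
    simp only [τ.injective.eq_iff, hm, transport_apply, Equiv.symm_apply_apply, ← map_sub,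
      LinearIsometryEquiv.norm_map]
  linarith

theorem pairEnergy_add_const (u : Plane) (q : Config N) (t : ℝ) :
    pairEnergy φ m (q + t • WithLp.toLp 2 fun _ => u) = pairEnergy φ m q := by
  simp [pairEnergy]

theorem contDiffAt_pairEnergy (hφ : ∀ r : ℝ, 0 < r → ContDiffAt ℝ 2 φ r) {x : Config N}
    (hx : Function.Injective fun i => x i) : ContDiffAt ℝ 2 (pairEnergy φ m) x := by
  unfold pairEnergy
  refine ContDiffAt.sum fun i _ => ContDiffAt.sum fun j hj => contDiffAt_const.mul ?_
  have hij : x i - x j ≠ 0 :=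
    sub_ne_zero.mpr (hx.ne (Finset.mem_Ioi.mp hj).ne)
  have h1 : ContDiffAt ℝ 2 (fun q : Config N => q i - q j) x := by fun_prop
  exact (hφ _ (norm_pos_iff.mpr hij)).comp x (h1.norm ℝ hij)

open scoped Topology in
theorem eventually_pairEnergy_smul {p : ℝ} {c : ℝ → ℝ}
    (hφ : ∀ t r : ℝ, 0 < t → 0 < r → φ (t * r) = t ^ p * φ r + c t) {x : Config N}
    (hx : Function.Injective fun i => x i) {t : ℝ} (ht : 0 < t) :
    ∀ᶠ q in 𝓝 x, pairEnergy φ m (t • q) =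
      t ^ p * pairEnergy φ m q + ∑ i, ∑ j ∈ Finset.Ioi i, m i * m j * c t := by
  have h1 : ∀ᶠ q in 𝓝 x, ∀ i, ∀ j ∈ Finset.Ioi i, q i - q j ≠ 0 := by
    simp only [Filter.eventually_all, Finset.mem_Ioi]
    intro i j hij
    have h2 : ContinuousAt (fun q : Config N => q i - q j) x := by fun_prop
    exact h2.eventually_ne (sub_ne_zero.mpr (hx.ne hij.ne))
  filter_upwards [h1] with q hq
  simp only [pairEnergy, Finset.mul_sum, ← Finset.sum_add_distrib]
  refine Finset.sum_congr rfl fun i _ => Finset.sum_congr rfl fun j hj => ?_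
  rw [PiLp.smul_apply, PiLp.smul_apply, ← smul_sub, norm_smul, Real.norm_of_nonneg ht.le,
    hφ t _ ht (norm_pos_iff.mpr (hq i j hj))]
  ring

/-- Rotation of the plane by the angle `t`. -/
noncomputable def rotIso (t : ℝ) : Plane ≃ₗᵢ[ℝ] Plane where
  toFun v := Real.cos t • v + Real.sin t • rotQuarter v
  invFun v := Real.cos t • v - Real.sin t • rotQuarter v
  left_inv v := by
    ext i
    fin_cases i <;> simp [rotQuarter]
    · linear_combination v 0 * Real.cos_sq_add_sin_sq t
    · linear_combination v 1 * Real.cos_sq_add_sin_sq t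
  right_inv v := by
    ext i
    fin_cases i <;> simp [rotQuarter]
    · linear_combination v 0 * Real.cos_sq_add_sin_sq t
    · linear_combination v 1 * Real.cos_sq_add_sin_sq t
  map_add' u v := by
    simp only [map_add, smul_add]
    abel
  map_smul' s v := by
    simp only [map_smul, smul_add, RingHom.id_apply, smul_comm s]
  norm_map' v := by
    change ‖Real.cos t • v + Real.sin t • rotQuarter v‖ = ‖v‖
    rw [EuclideanSpace.norm_eq, EuclideanSpace.norm_eq]
    congr 1
    simp only [Fin.sum_univ_two, Real.norm_eq_abs, sq_abs]
    simp [rotQuarter]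
    linear_combination (v 0 ^ 2 + v 1 ^ 2) * Real.cos_sq_add_sin_sq t

/-- The operator `M⁻¹ D∇F(x)` of a pair energy `F`. -/
noncomputable def pairOp (x : Config N) : Config N →ₗ[ℝ] Config N :=
  diagOp m⁻¹ ∘ₗ hess (pairEnergy φ m) x

variable {φ m}

/-- The Hessian is equivariant because `x` is fixed, and `M⁻¹` is because masses are constant on
orbits. -/
theorem pairOp_mul_rep {n : ℕ} [NeZero n] {σ : DihedralGroup n →* Equiv.Perm (Fin N)}
    {x : Config N} (hσ : ∀ g i, x (σ g i) = act g (x i)) (hm : ∀ g i, m (σ g i) = m i)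
    (g : DihedralGroup n) : pairOp φ m x * rep σ g = rep σ g * pairOp φ m x := by
  refine LinearMap.ext fun u => ?_
  have h1 : hess (pairEnergy φ m) x (rep σ g u) = rep σ g (hess (pairEnergy φ m) x u) :=
    fderiv_gradient_comp_of_invariant (transport (actIso g) (σ g))
      (pairEnergy_transport φ m _ _ (hm g)) (rep_self σ hσ g) u
  rw [Module.End.mul_apply, Module.End.mul_apply, pairOp, LinearMap.comp_apply,
    LinearMap.comp_apply, h1]
  ext1 i
  rw [diagOp_apply, rep_apply, rep_apply, diagOp_apply, Pi.inv_apply, Pi.inv_apply, hm]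
  exact ((actIso g).map_smul _ _).symm

theorem massInner_pairOp (hφ : ∀ r : ℝ, 0 < r → ContDiffAt ℝ 2 φ r) {x : Config N}
    (hx : Function.Injective fun i => x i) (hm : ∀ i, m i ≠ 0) (u w : Config N) :
    massInner m (pairOp φ m x u) w = massInner m u (pairOp φ m x w) := by
  have h (y : Config N) : diagOp m (diagOp m⁻¹ y) = y :=
    LinearMap.congr_fun (diagOp_mul_diagOp m m⁻¹ fun i => by simp [hm i]) y
  rw [massInner_comm, massInner_eq_inner, massInner_eq_inner, pairOp, LinearMap.comp_apply,
    LinearMap.comp_apply, h, h, real_inner_comm]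
  exact inner_fderiv_gradient_comm (contDiffAt_pairEnergy φ m hφ hx) u w

theorem pairOp_transH (x : Config N) : pairOp φ m x (transH N) = 0 := by
  rw [pairOp, LinearMap.comp_apply, hess_apply, fderiv_gradient_eq_zero_of_invariant, map_zero]
  exact pairEnergy_add_const φ m _

theorem pairOp_transV (x : Config N) : pairOp φ m x (transV N) = 0 := by
  rw [pairOp, LinearMap.comp_apply, hess_apply, fderiv_gradient_eq_zero_of_invariant, map_zero]
  exact pairEnergy_add_const φ m _

/-- Homogeneity gives the eigenvalue of `x` and rotation invariance that of `Jx`. The `N`-body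
problem has `p = 2γ + 2`, `μ = ω²`, the `N`-vortex problem `p = 0`, `μ = -ω`. -/
theorem pairOp_of_gradient_eq (hφ : ∀ r : ℝ, 0 < r → ContDiffAt ℝ 2 φ r) {x : Config N}
    (hx : Function.Injective fun i => x i) (hm : ∀ i, m i ≠ 0) {p : ℝ} {c : ℝ → ℝ}
    (hφ' : ∀ t r : ℝ, 0 < t → 0 < r → φ (t * r) = t ^ p * φ r + c t) {μ : ℝ}
    (hg : gradient (pairEnergy φ m) x = μ • diagOp m x) :
    pairOp φ m x x = ((p - 1) * μ) • x ∧ pairOp φ m x (J N x) = μ • J N x := by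
  have h (y : Config N) : diagOp m⁻¹ (diagOp m y) = y :=
    LinearMap.congr_fun (diagOp_mul_diagOp m⁻¹ m fun i => by simp [hm i]) y
  have hC := contDiffAt_pairEnergy φ m hφ hx
  constructor
  · rw [pairOp, LinearMap.comp_apply, hess_apply, fderiv_gradient_apply_self hC p _
      fun t ht => eventually_pairEnergy_smul φ m hφ' hx ht, hg, map_smul, map_smul, h, smul_smul]
  · rw [pairOp, LinearMap.comp_apply, hess_apply,
      fderiv_gradient_apply_rotation hC (J N) (fun t => transport (rotIso t) 1)
      (fun t => pairEnergy_transport φ m _ _ fun i => rfl) (fun t q => rfl), hg, map_smul, map_smul,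
      ← Module.End.mul_apply (J N), J_mul_diagOp, Module.End.mul_apply, h]

end PairEnergy

/-! ### Relative equilibria -/

theorem contDiffAt_potential_profile (γ : ℝ) (r : ℝ) (hr : 0 < r) :
    ContDiffAt ℝ 2 (fun t : ℝ => 1 / (2 * γ + 2) * t ^ (2 * γ + 2)) r :=
  contDiffAt_const.mul (Real.contDiffAt_rpow_const_of_ne hr.ne')

theorem contDiffAt_vortex_profile (r : ℝ) (hr : 0 < r) :
    ContDiffAt ℝ 2 (fun t : ℝ => -Real.log t) r :=
  (Real.contDiffAt_log.mpr hr.ne').neg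

theorem hasDerivAt_apply_line {V W : Type*} [NormedAddCommGroup V] [NormedSpace ℝ V]
    [NormedAddCommGroup W] [NormedSpace ℝ W] (T : V →ₗ[ℝ] W) (u w : V) :
    HasDerivAt (fun s : ℝ => T (u + s • w)) (T w) 0 := by
  have h := ((hasDerivAt_id (0 : ℝ)).smul_const (T w)).const_add (T u)
  simpa using h

theorem inner_J_right {N : ℕ} (u w : Config N) : inner ℝ u (J N w) = -inner ℝ (J N u) w := by
  simp only [PiLp.inner_apply, J_apply, ← Finset.sum_neg_distrib]
  refine Finset.sum_congr rfl fun i _ => ?_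
  simp [rotQuarter, Fin.sum_univ_two]

theorem inner_diagOp {N : ℕ} (w : Fin N → ℝ) (u v : Config N) :
    inner ℝ u (diagOp w v) = inner ℝ (diagOp w u) v := by
  rw [← massInner_eq_inner, massInner_comm, massInner_eq_inner, real_inner_comm]

/-- Criticality in the momentum gives `ν = ωMJx`, criticality in the position gives `∇U = -ωJν`;
eliminate `ν` with `J² = -1`. -/
theorem IsRelEquilibrium.gradient_eq {N : ℕ} {γ : ℝ} {m : Fin N → ℝ} {ω : ℝ} {x : Config N}
    (hx : Function.Injective fun i => x i) (hm : ∀ i, m i ≠ 0) (h : IsRelEquilibrium γ m ω x) :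
    gradient (potential γ m) x = ω ^ 2 • diagOp m x := by
  obtain ⟨ν, h⟩ := h
  have hU : DifferentiableAt ℝ (potential γ m) x := by
    rw [potential_eq_pairEnergy]
    exact (contDiffAt_pairEnergy _ m (contDiffAt_potential_profile γ) hx).differentiableAt
      (by norm_num)
  have hline (z : Config N × Config N) :
      HasDerivAt (fun s : ℝ => rotHamiltonian γ m ω ((x, ν) + s • z)) 0 0 := by
    have h0 : HasFDerivAt (rotHamiltonian γ m ω) (0 : Config N × Config N →L[ℝ] ℝ)
        ((x, ν) + (0 : ℝ) • z) := by simpa using h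
    exact h0.comp_hasDerivAt (0 : ℝ) (hasDerivAt_apply_line LinearMap.id (x, ν) z)
  have h1 : diagOp m⁻¹ ν = ω • J N x := by
    refine ext_inner_right ℝ fun η => ?_
    have e1 := hline (0, η)
    have e2 := ((((hasDerivAt_apply_line LinearMap.id ν η).inner ℝ
      (hasDerivAt_apply_line (diagOp m⁻¹) ν η)).const_mul (1 / 2 : ℝ)).add
      (((hasDerivAt_const (0 : ℝ) x).inner ℝ
        (hasDerivAt_apply_line (J N) ν η)).const_mul ω)).add_const (potential γ m x)
    have e3 := (e1.congr_of_eventuallyEq (f₁ := _) (Filter.Eventually.of_forall fun s => ?_)).unique e2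
    · simp only [LinearMap.id_apply, zero_smul, add_zero, inner_zero_left, inner_J_right,
        inner_diagOp] at e3
      rw [← inner_diagOp m⁻¹ η, real_inner_comm η] at e3
      rw [real_inner_smul_left, real_inner_comm η]
      linarith
    · simp [rotHamiltonian]
  have h2 : gradient (potential γ m) x = -(ω • J N ν) := by
    refine ext_inner_right ℝ fun ξ => ?_
    have e1 := hline (ξ, 0)
    have e4 : HasDerivAt (fun s : ℝ => potential γ m (x + s • ξ))
        (fderiv ℝ (potential γ m) x ξ) 0 := by
      have h0 : HasFDerivAt (potential γ m) (fderiv ℝ (potential γ m) x) (x + (0 : ℝ) • ξ) := by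
        simpa using hU.hasFDerivAt
      exact h0.comp_hasDerivAt (0 : ℝ) (hasDerivAt_apply_line LinearMap.id x ξ)
    have e2 := ((((hasDerivAt_apply_line LinearMap.id x ξ).inner ℝ
      (hasDerivAt_const (0 : ℝ) (J N ν))).const_mul ω).const_add
        (1 / 2 * inner ℝ ν (diagOp m⁻¹ ν))).add e4
    have e3 := (e1.congr_of_eventuallyEq (f₁ := _) (Filter.Eventually.of_forall fun s => ?_)).unique e2
    · simp only [LinearMap.id_apply, zero_smul, add_zero, inner_zero_right, zero_add] at e3
      rw [inner_gradient, inner_neg_left, real_inner_smul_left, real_inner_comm]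
      linarith
    · simp [rotHamiltonian]
  have h3 : ν = ω • diagOp m (J N x) := by
    rw [← map_smul, ← h1]
    exact (LinearMap.congr_fun (diagOp_mul_diagOp m m⁻¹ fun i => by simp [hm i]) ν).symm
  rw [h2, h3, map_smul, ← Module.End.mul_apply (J N), J_mul_diagOp, Module.End.mul_apply, J_J,
    map_neg, smul_smul, smul_neg, neg_neg, sq]

theorem IsVortexRelEquilibrium.gradient_eq {N : ℕ} {m : Fin N → ℝ} {ω : ℝ} {x : Config N}
    (hx : Function.Injective fun i => x i) (h : IsVortexRelEquilibrium m ω x) :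
    gradient (vortexH m) x = (-ω) • diagOp m x := by
  have hU : DifferentiableAt ℝ (vortexH m) x := by
    rw [vortexH_eq_pairEnergy]
    exact (contDiffAt_pairEnergy _ m contDiffAt_vortex_profile hx).differentiableAt (by norm_num)
  refine ext_inner_right ℝ fun ξ => ?_
  have e1 : HasDerivAt (fun s : ℝ => rotVortexHamiltonian m ω (x + s • ξ)) 0 0 := by
    have h0 : HasFDerivAt (rotVortexHamiltonian m ω) (0 : Config N →L[ℝ] ℝ)
        (x + (0 : ℝ) • ξ) := by rw [zero_smul, add_zero]; exact h
    exact h0.comp_hasDerivAt (0 : ℝ) (hasDerivAt_apply_line LinearMap.id x ξ)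
  have e4 : HasDerivAt (fun s : ℝ => vortexH m (x + s • ξ)) (fderiv ℝ (vortexH m) x ξ) 0 := by
    have h0 : HasFDerivAt (vortexH m) (fderiv ℝ (vortexH m) x) (x + (0 : ℝ) • ξ) := by
      simpa using hU.hasFDerivAt
    exact h0.comp_hasDerivAt (0 : ℝ) (hasDerivAt_apply_line LinearMap.id x ξ)
  have e2 := (((hasDerivAt_apply_line LinearMap.id x ξ).inner ℝ
    (hasDerivAt_apply_line (diagOp m) x ξ)).const_mul (ω / 2)).add e4
  have e3 := e1.unique e2
  simp only [LinearMap.id_apply, zero_smul, add_zero, inner_diagOp] at e3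
  rw [← inner_diagOp m ξ, real_inner_comm (diagOp m x) ξ] at e3
  rw [inner_gradient, real_inner_smul_left]
  linarith

/-! ### The isotypic components as blocks -/

/-- The index of the isotypic component of the rotation group to which a block belongs. -/
def blockFreq (n : ℕ) : Block n → ℕ
  | Sum.inl i => if (i : ℕ) = 0 then 0 else n / 2
  | Sum.inr (Sum.inl i) => i + 2
  | Sum.inr (Sum.inr _) => 1

/-- The sign by which the reflection `s` acts on the first half of a block. -/
def blockSign (n : ℕ) : Block n → ℤˣ
  | Sum.inr (Sum.inr _) => 1
  | _ => -1

theorem two_mul_blockFreq_le {n : ℕ} (hn : 2 < n) (j : Block n) : 2 * blockFreq n j ≤ n := by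
  rcases j with i | i | i
  · simp only [blockFreq]
    split <;> omega
  · have hi := i.2
    simp only [blockFreq]
    unfold numMiddle at hi
    split at hi <;> omega
  · simp only [blockFreq]
    omega

/-- The blocks enumerate frequencies in `[0, n/2]`: `0`, then `n/2` if `n` is even, the values from
`2` to below `n/2`, and `1`. Since `n > 2`, an exact half `n/2` is at least `2`. -/
theorem blockFreq_injective {n : ℕ} (hn : 2 < n) : Function.Injective (blockFreq n) := by
  have hs (i : Fin (numSmall n)) (hi : (i : ℕ) ≠ 0) : Even n ∧ (i : ℕ) = 1 := by
    have h := i.2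
    unfold numSmall at h
    split at h
    · exact ⟨by assumption, by omega⟩
    · omega
  have hm (i : Fin (numMiddle n)) : 2 * ((i : ℕ) + 2) < n := by
    have h := i.2
    unfold numMiddle at h
    split at h <;> omega
  rintro (i | i | i) (k | k | k) h <;> simp only [blockFreq] at h
  · congr 1
    apply Fin.ext
    by_cases hi : (i : ℕ) = 0 <;> by_cases hk : (k : ℕ) = 0 <;>
      simp only [hi, hk, if_true, if_false] at h ⊢
    · omega
    · omega
    · rw [(hs i hi).2, (hs k hk).2]
  · have := hm k
    split at h
    · omega
    · obtain ⟨t, ht⟩ := (hs i ‹_›).1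
      omega
  · split at h
    · omega
    · obtain ⟨t, ht⟩ := (hs i ‹_›).1
      omega
  · have := hm i
    split at h
    · omega
    · obtain ⟨t, ht⟩ := (hs k ‹_›).1
      omega
  · rw [Fin.ext (show (i : ℕ) = k by omega)]
  · omega
  · split at h
    · omega
    · obtain ⟨t, ht⟩ := (hs k ‹_›).1
      omega
  · omega
  · rfl

theorem natCast_zmod_eq_iff {n k l : ℕ} (hn : 2 < n) (hk : 2 * k ≤ n) (hl : 2 * l ≤ n) :
    (k : ZMod n) = l ↔ k = l := by
  rw [ZMod.natCast_eq_natCast_iff', Nat.mod_eq_of_lt (by omega), Nat.mod_eq_of_lt (by omega)]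

theorem natCast_zmod_eq_neg_iff {n k l : ℕ} (hk : 2 * k ≤ n) (hl : 2 * l ≤ n) :
    (k : ZMod n) = -l ↔ k + l = 0 ∨ k + l = n := by
  rw [eq_neg_iff_add_eq_zero, ← Nat.cast_add, ZMod.natCast_eq_zero_iff]
  constructor
  · intro h
    rcases Nat.eq_zero_or_pos (k + l) with h0 | h0
    · exact Or.inl h0
    · have := Nat.le_of_dvd h0 h
      omega
  · rintro (h | h) <;> simp [h]

/-- Residues modulo `n` up to sign have unique representatives in `[0, n/2]`, so distinct blocks use
distinct pairs `±k`. -/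
theorem blockFreq_ne {n : ℕ} (hn : 2 < n) {j k : Block n} (h : j ≠ k) :
    (blockFreq n j : ZMod n) ≠ blockFreq n k ∧ (blockFreq n j : ZMod n) ≠ -blockFreq n k := by
  have h1 := two_mul_blockFreq_le hn j
  have h2 := two_mul_blockFreq_le hn k
  have h3 := (blockFreq_injective hn).ne h
  constructor
  · rwa [Ne, natCast_zmod_eq_iff hn h1 h2]
  · rw [Ne, natCast_zmod_eq_neg_iff h1 h2]
    omega

theorem halfSize_pos {n a b c : ℕ} (h : 0 < b + 2 * c) (j : Block n) : 0 < halfSize n a b c j := by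
  rcases j with i | i | i <;> simp only [halfSize] <;> omega

theorem sum_halfSize {n : ℕ} (hn : 2 < n) (a b c : ℕ) :
    ∑ j, halfSize n a b c j = a + n * (b + 2 * c) := by
  rw [Fintype.sum_sum_type, Fintype.sum_sum_type]
  simp only [halfSize, Finset.sum_const, Finset.card_univ, Fintype.card_fin, smul_eq_mul,
    Fintype.card_unit, one_mul]
  rcases Nat.even_or_odd' n with ⟨t, rfl | rfl⟩
  · obtain ⟨s, rfl⟩ : ∃ s, t = s + 2 := ⟨t - 2, by omega⟩
    rw [numSmall, numMiddle, if_pos (by simp), if_pos (by simp),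
      show 2 * (s + 2) / 2 - 2 = s by omega]
    ring
  · obtain ⟨s, rfl⟩ : ∃ s, t = s + 1 := ⟨t - 1, by omega⟩
    have ho : ¬Even (2 * (s + 1) + 1) := by simp
    rw [numSmall, numMiddle, if_neg ho, if_neg ho, show (2 * (s + 1) + 1 - 3) / 2 = s by omega]
    ring

/-! ### The adapted basis and its block form -/

section Basis

variable {n a b c N : ℕ} [NeZero n] (σ : DihedralGroup n →* Equiv.Perm (Fin N))

/-- With `N - a = n(b + 2c)` the trace formula gives `b + 2c` at the self-conjugate frequencies `0`
and `n/2`, and twice that elsewhere, plus `a` at frequency `1`. -/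
theorem finrank_isoSpace_block (hn : 2 < n) {x : Config N} (hx : Function.Injective fun i => x i)
    (hX : IsRingSystem n (Set.range fun i => x i) a b c)
    (hσ : ∀ g i, x (σ g i) = act g (x i)) (j : Block n) (ε : ℤˣ) :
    Module.finrank ℝ (isoSpace σ (blockFreq n j : ZMod n) ε) = halfSize n a b c j := by
  obtain ⟨ha, hN, -⟩ := hX.count hn hx
  have h := finrank_isoSpace σ hx hσ (blockFreq n j : ZMod n) ε
  have hle := two_mul_blockFreq_le hn j
  have h1 : (blockFreq n j : ZMod n) = 1 ↔ blockFreq n j = 1 := by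
    rw [← natCast_zmod_eq_iff hn hle (show 2 * 1 ≤ n by omega), Nat.cast_one]
  have h2 : (blockFreq n j : ZMod n) = -1 ↔ False := by
    have h3 := natCast_zmod_eq_neg_iff hle (show 2 * 1 ≤ n by omega)
    rw [Nat.cast_one] at h3
    rw [h3, iff_false]
    omega
  have h3 : (blockFreq n j : ZMod n) = -blockFreq n j ↔
      blockFreq n j = 0 ∨ 2 * blockFreq n j = n := by
    rw [natCast_zmod_eq_neg_iff hle hle]
    omega
  have hN' : (N : ℝ) - a = n * (b + 2 * c) := by
    rw [hN]
    push_cast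
    ring
  have h0 := natCast_ne_zero_real (n := n)
  rw [isoCoeff, ha, hN'] at h
  simp only [h1, h2, h3, if_false, add_zero] at h
  have key : (Module.finrank ℝ (isoSpace σ (blockFreq n j : ZMod n) ε) : ℝ) =
      (halfSize n a b c j : ℝ) := by
    rw [h]
    rcases j with i | i | i
    · have h4 : blockFreq n (Sum.inl i) = 0 ∨ 2 * blockFreq n (Sum.inl i) = n := by
        have hi := i.2
        simp only [blockFreq]
        unfold numSmall at hi
        split at hi
        · rename_i he
          obtain ⟨t, rfl⟩ := he
          split <;> omega
        · rw [if_pos (by omega)]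
          exact Or.inl rfl
      have h5 : blockFreq n (Sum.inl i) ≠ 1 := by omega
      rw [if_pos h4, if_neg h5]
      simp only [halfSize]
      push_cast
      field_simp
      ring
    · have h5 : blockFreq n (Sum.inr (Sum.inl i)) ≠ 1 := by simp [blockFreq]
      have h4 : ¬(blockFreq n (Sum.inr (Sum.inl i)) = 0 ∨
          2 * blockFreq n (Sum.inr (Sum.inl i)) = n) := by
        have hi := i.2
        simp only [blockFreq]
        unfold numMiddle at hi
        split at hi <;> omega
      rw [if_neg h4, if_neg h5]
      simp only [halfSize]
      push_cast
      field_simp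
      ring
    · have h5 : blockFreq n (Sum.inr (Sum.inr i)) = 1 := rfl
      rw [if_neg (by omega), if_pos h5]
      simp only [halfSize]
      push_cast
      field_simp
      ring
  exact_mod_cast key

/-- A basis of displacements arranged in blocks and adapted to the decomposition into isotypic
components, to the mass inner product and to `J`. -/
structure IsAdapted (m : Fin N → ℝ) (v : Module.Basis (BlockIndex n a b c) ℝ (Config N)) :
    Prop where
  orthogonal : ∀ p q, p ≠ q → massInner m (v p) (v q) = 0
  ne_zero : ∀ p, massInner m (v p) (v p) ≠ 0
  inr_eq : ∀ j i, v ⟨j, Sum.inr i⟩ = -J N (v ⟨j, Sum.inl i⟩)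
  mem_inl : ∀ j i, v ⟨j, Sum.inl i⟩ ∈ isoSpace σ (blockFreq n j : ZMod n) (blockSign n j)
  mem_inr : ∀ j i, v ⟨j, Sum.inr i⟩ ∈ isoSpace σ (blockFreq n j : ZMod n) (-blockSign n j)

theorem neg_J_mem_isoSpace {k : ZMod n} {ε : ℤˣ} {u : Config N} (hu : u ∈ isoSpace σ k ε) :
    -J N u ∈ isoSpace σ k (-ε) := Submodule.neg_mem _ (J_mem_isoSpace σ hu)

/-- The first half of each block is an orthogonal basis of one isotypic piece, through `u j` when
this is non-isotropic. The second half is its image under the mass isometry `-J`; the sign makes the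
matrix of `J` equal to `[[0, 1], [-1, 0]]`. The family is orthogonal without isotropic vectors,
hence independent, and has `2N` members. -/
theorem exists_isAdapted (hn : 2 < n) {x : Config N} (hx : Function.Injective fun i => x i)
    (hX : IsRingSystem n (Set.range fun i => x i) a b c)
    (hσ : ∀ g i, x (σ g i) = act g (x i)) {m : Fin N → ℝ} (hm0 : ∀ i, m i ≠ 0)
    (hm : ∀ g i, m (σ g i) = m i) (u : Block n → Config N)
    (hu : ∀ j, u j ∈ isoSpace σ (blockFreq n j : ZMod n) (blockSign n j)) :
    ∃ (v : Module.Basis (BlockIndex n a b c) ℝ (Config N)) (i : ∀ j, Fin (halfSize n a b c j)),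
      IsAdapted σ m v ∧ ∀ j, massInner m (u j) (u j) ≠ 0 → v ⟨j, Sum.inl (i j)⟩ = u j := by
  obtain ⟨-, hN, hpos⟩ := hX.count hn hx
  have hex (j : Block n) : ∃ (w : Fin (halfSize n a b c j) → Config N)
      (i : Fin (halfSize n a b c j)), (massInner m (u j) (u j) ≠ 0 → w i = u j) ∧
      (∀ i, w i ∈ isoSpace σ (blockFreq n j : ZMod n) (blockSign n j)) ∧
      (∀ i k, i ≠ k → massInner m (w i) (w k) = 0) ∧ ∀ i, massInner m (w i) (w i) ≠ 0 := by
    have h := exists_orthogonal_family (massForm m) (massInner_comm m) _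
      (isoSpace σ (blockFreq n j : ZMod n) (blockSign n j))
      (fun y hy => eq_zero_of_mem_isoSpace σ hm hm0 hy)
      (finrank_isoSpace_block σ hn hx hX hσ j (blockSign n j))
    by_cases hj : massInner m (u j) (u j) = 0
    · obtain ⟨w, hw⟩ := h.1
      -- For isotropic `u j` nothing is prescribed and any index serves.
      exact ⟨w, ⟨0, halfSize_pos hpos j⟩, fun h => absurd hj h, hw⟩
    · obtain ⟨w, i, hwi, hw⟩ := h.2 (u j) (hu j) hj
      exact ⟨w, i, fun _ => hwi, hw⟩
  choose w i hwi hmem horth hne using hex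
  let f : BlockIndex n a b c → Config N := fun p => Sum.elim (w p.1) (fun k => -J N (w p.1 k)) p.2
  have fmem : ∀ p : BlockIndex n a b c, f p ∈ isoSpace σ (blockFreq n p.1 : ZMod n)
      (Sum.elim (fun _ => blockSign n p.1) (fun _ => -blockSign n p.1) p.2) := by
    rintro ⟨j, k | k⟩
    · exact hmem j k
    · exact neg_J_mem_isoSpace σ (hmem j k)
  have hJJ (y z : Config N) : massInner m (-J N y) (-J N z) = massInner m y z := by
    rw [← massInner_J_J m y z, ← massForm_apply, ← massForm_apply, map_neg, map_neg,
      LinearMap.neg_apply, neg_neg]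
  have hsign (ε : ℤˣ) : ε ≠ -ε := by
    rcases Int.units_eq_one_or ε with rfl | rfl <;> decide
  have forth : ∀ p q, p ≠ q → massInner m (f p) (f q) = 0 := by
    rintro ⟨j, k⟩ ⟨j', k'⟩ hpq
    rcases eq_or_ne j j' with rfl | hjj
    · rcases k with k | k <;> rcases k' with k' | k'
      · exact horth j k k' fun h => hpq (by rw [h])
      · exact massInner_eq_zero_of_mem_isoSpace σ hm (Or.inr (hsign _)) (fmem ⟨j, Sum.inl k⟩)
          (fmem ⟨j, Sum.inr k'⟩)
      · exact massInner_eq_zero_of_mem_isoSpace σ hm (Or.inr (hsign _).symm) (fmem ⟨j, Sum.inr k⟩)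
          (fmem ⟨j, Sum.inl k'⟩)
      · exact (hJJ _ _).trans (horth j k k' fun h => hpq (by rw [h]))
    · exact massInner_eq_zero_of_mem_isoSpace σ hm (Or.inl (blockFreq_ne hn hjj)) (fmem ⟨j, k⟩)
        (fmem ⟨j', k'⟩)
  have fne : ∀ p, massInner m (f p) (f p) ≠ 0 := by
    rintro ⟨j, k | k⟩
    · exact hne j k
    · exact fun h => hne j k ((hJJ _ _).symm.trans h)
  have hli : LinearIndependent ℝ f :=
    LinearMap.BilinForm.linearIndependent_of_iIsOrtho (B := massForm m)
      (LinearMap.isOrthoᵢ_def.mpr forth) fne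
  have hcard : Fintype.card (BlockIndex n a b c) = Module.finrank ℝ (Config N) := by
    rw [Fintype.card_sigma]
    simp only [Fintype.card_sum, Fintype.card_fin, Finset.sum_add_distrib, sum_halfSize hn]
    rw [← hN, (WithLp.linearEquiv 2 ℝ (Fin N → Plane)).finrank_eq, Module.finrank_pi_fintype]
    simp
    ring
  have : Nonempty (BlockIndex n a b c) :=
    ⟨⟨lastBlock n, Sum.inl ⟨0, halfSize_pos hpos _⟩⟩⟩
  refine ⟨basisOfLinearIndependentOfCardEqFinrank hli hcard, i, ⟨?_, ?_, ?_, ?_, ?_⟩, ?_⟩ <;>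
    simp only [coe_basisOfLinearIndependentOfCardEqFinrank]
  · exact forth
  · exact fne
  · exact fun j k => rfl
  · exact fun j k => fmem ⟨j, Sum.inl k⟩
  · exact fun j k => fmem ⟨j, Sum.inr k⟩
  · exact hwi

/-- The restriction of `A` to the first half of a block. -/
noncomputable def leftBlock (v : Module.Basis (BlockIndex n a b c) ℝ (Config N))
    (A : Config N →ₗ[ℝ] Config N) (j : Block n) :
    Matrix (Fin (halfSize n a b c j)) (Fin (halfSize n a b c j)) ℝ :=
  Matrix.of fun i k => v.repr (A (v ⟨j, Sum.inl k⟩)) ⟨j, Sum.inl i⟩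

/-- The restriction of `A` to the second half of a block. -/
noncomputable def rightBlock (v : Module.Basis (BlockIndex n a b c) ℝ (Config N))
    (A : Config N →ₗ[ℝ] Config N) (j : Block n) :
    Matrix (Fin (halfSize n a b c j)) (Fin (halfSize n a b c j)) ℝ :=
  Matrix.of fun i k => v.repr (A (v ⟨j, Sum.inr k⟩)) ⟨j, Sum.inr i⟩

namespace IsAdapted

variable {σ} {m : Fin N → ℝ} {v : Module.Basis (BlockIndex n a b c) ℝ (Config N)}
  (hv : IsAdapted σ m v)

include hv

theorem massInner_eq_repr_mul (u : Config N) (p : BlockIndex n a b c) :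
    massInner m u (v p) = v.repr u p * massInner m (v p) (v p) := by
  conv_lhs => rw [← v.sum_repr u]
  rw [← massForm_apply, map_sum, LinearMap.sum_apply, Finset.sum_eq_single p]
  · simp
  · intro q _ hq
    simp [hv.orthogonal q p hq]
  · simp

theorem repr_eq_zero {u : Config N} {p : BlockIndex n a b c} (h : massInner m u (v p) = 0) :
    v.repr u p = 0 := by
  rw [hv.massInner_eq_repr_mul] at h
  exact (mul_eq_zero.mp h).resolve_right (hv.ne_zero p)

theorem mem (p : BlockIndex n a b c) : v p ∈ isoSpace σ (blockFreq n p.1 : ZMod n)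
    (Sum.elim (fun _ => blockSign n p.1) (fun _ => -blockSign n p.1) p.2) := by
  obtain ⟨j, i | i⟩ := p
  · exact hv.mem_inl j i
  · exact hv.mem_inr j i

theorem repr_eq_zero_of_mem (hn : 2 < n) (hm : ∀ g i, m (σ g i) = m i) {u : Config N}
    {j : Block n} {ε : ℤˣ} (hu : u ∈ isoSpace σ (blockFreq n j : ZMod n) ε)
    {p : BlockIndex n a b c} (hp : p.1 ≠ j ∨
      Sum.elim (fun _ => blockSign n p.1) (fun _ => -blockSign n p.1) p.2 ≠ ε) :
    v.repr u p = 0 := by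
  refine hv.repr_eq_zero (massInner_eq_zero_of_mem_isoSpace σ hm ?_ hu (hv.mem p))
  rcases hp with hp | hp
  · exact Or.inl (blockFreq_ne hn hp.symm)
  · exact Or.inr hp.symm

theorem J_inl (j : Block n) (i : Fin (halfSize n a b c j)) :
    J N (v ⟨j, Sum.inl i⟩) = -v ⟨j, Sum.inr i⟩ := by
  rw [hv.inr_eq, neg_neg]

theorem J_inr (j : Block n) (i : Fin (halfSize n a b c j)) :
    J N (v ⟨j, Sum.inr i⟩) = v ⟨j, Sum.inl i⟩ := by
  rw [hv.inr_eq, map_neg, J_J, neg_neg]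

theorem hasBlockForm (hn : 2 < n) (hm : ∀ g i, m (σ g i) = m i) {A : Config N →ₗ[ℝ] Config N}
    (hA : ∀ g, A * rep σ g = rep σ g * A) :
    HasBlockForm v A (leftBlock v A) (rightBlock v A) := by
  intro s
  ext ⟨j, i⟩ ⟨k, l⟩
  rw [LinearMap.toMatrix_apply, LinearMap.add_apply, LinearMap.smul_apply, map_add, map_smul,
    Finsupp.add_apply, Finsupp.smul_apply]
  have hAm := map_mem_isoSpace σ hA (hv.mem ⟨k, l⟩)
  rcases eq_or_ne j k with rfl | hjk
  · rw [Matrix.blockDiagonal'_apply_eq]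
    rcases i with i | i <;> rcases l with l | l
    · rw [hv.J_inl]
      simp [leftBlock]
    · rw [hv.J_inr, hv.repr_eq_zero_of_mem hn hm hAm (Or.inr (by simp))]
      simp [Matrix.one_apply, Finsupp.single_apply, eq_comm]
    · rw [hv.J_inl, hv.repr_eq_zero_of_mem hn hm hAm (Or.inr (by simp))]
      simp [Matrix.one_apply, Finsupp.single_apply, eq_comm]
    · rw [hv.J_inr]
      simp [rightBlock]
  · rw [Matrix.blockDiagonal'_apply_ne _ _ _ hjk, hv.repr_eq_zero_of_mem hn hm hAm (Or.inl hjk)]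
    rcases l with l | l
    · simp [hv.J_inl, hjk.symm]
    · simp [hv.J_inr, hjk.symm]

/-- For an eigenvector in the basis the column is clear; the row vanishes by self-adjointness and
orthogonality. -/
theorem repr_apply_symm {A : Config N →ₗ[ℝ] Config N}
    (hA : ∀ u w, massInner m (A u) w = massInner m u (A w)) {p : BlockIndex n a b c} {t : ℝ}
    (hp : A (v p) = t • v p) {q : BlockIndex n a b c} (hq : q ≠ p) : v.repr (A (v q)) p = 0 := by
  refine hv.repr_eq_zero ?_
  rw [hA, hp, ← massForm_apply, map_smul, massForm_apply, hv.orthogonal q p hq, smul_zero]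

theorem splitsAt_leftBlock {A : Config N →ₗ[ℝ] Config N}
    (hA : ∀ u w, massInner m (A u) w = massInner m u (A w)) {j : Block n}
    {i : Fin (halfSize n a b c j)} {t : ℝ} (hp : A (v ⟨j, Sum.inl i⟩) = t • v ⟨j, Sum.inl i⟩) :
    SplitsAt (leftBlock v A j) i ∧ leftBlock v A j i i = t := by
  refine ⟨fun k hk => ⟨?_, ?_⟩, ?_⟩
  · simp [leftBlock, hp, hk.symm]
  · exact hv.repr_apply_symm hA hp (by simpa using hk)
  · simp [leftBlock, hp]

theorem splitsAt_rightBlock {A : Config N →ₗ[ℝ] Config N}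
    (hA : ∀ u w, massInner m (A u) w = massInner m u (A w)) {j : Block n}
    {i : Fin (halfSize n a b c j)} {t : ℝ} (hp : A (v ⟨j, Sum.inr i⟩) = t • v ⟨j, Sum.inr i⟩) :
    SplitsAt (rightBlock v A j) i ∧ rightBlock v A j i i = t := by
  refine ⟨fun k hk => ⟨?_, ?_⟩, ?_⟩
  · simp [rightBlock, hp, hk.symm]
  · exact hv.repr_apply_symm hA hp (by simpa using hk)
  · simp [rightBlock, hp]

/-- Since `J` maps the second half of the basis to the first, `Jδ` has there the coordinates that
`δ` has in the second half. As `δ` need not belong to the basis, it may be isotropic. -/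
theorem exists_eigenvector (hn : 2 < n) (hm : ∀ g i, m (σ g i) = m i)
    {A : Config N →ₗ[ℝ] Config N} {j : Block n} {δ : Config N} (hδ : δ ≠ 0)
    (hmem : δ ∈ isoSpace σ (blockFreq n j : ZMod n) (-blockSign n j)) {s t : ℝ}
    (hs : A (J N δ) = s • J N δ) (ht : A δ = t • δ) :
    ∃ β : Fin (halfSize n a b c j) → ℝ, β ≠ 0 ∧ (leftBlock v A j).mulVec β = s • β ∧
      (rightBlock v A j).mulVec β = t • β := by
  have hsign (ε : ℤˣ) : ε ≠ -ε := by
    rcases Int.units_eq_one_or ε with rfl | rfl <;> decide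
  let β : Fin (halfSize n a b c j) → ℝ := fun i => v.repr δ ⟨j, Sum.inr i⟩
  have h1 : δ = ∑ i, β i • v ⟨j, Sum.inr i⟩ := by
    conv_lhs => rw [← v.sum_repr δ]
    rw [Fintype.sum_sigma, Finset.sum_eq_single j, Fintype.sum_sum_type,
      Finset.sum_eq_zero (s := Finset.univ (α := Fin (halfSize n a b c j))), zero_add]
    · intro i _
      rw [hv.repr_eq_zero_of_mem hn hm hmem (Or.inr (hsign _)), zero_smul]
    · intro k _ hk
      refine Finset.sum_eq_zero fun i _ => ?_
      rw [hv.repr_eq_zero_of_mem hn hm hmem (Or.inl hk), zero_smul]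
    · simp
  have h2 : J N δ = ∑ i, β i • v ⟨j, Sum.inl i⟩ := by
    conv_lhs => rw [h1]
    simp only [map_sum, map_smul, hv.J_inr]
  have h3 (i) : v.repr (J N δ) ⟨j, Sum.inl i⟩ = β i := by
    rw [h2]
    simp [Finsupp.single_apply]
  refine ⟨β, fun h => hδ ?_, ?_, ?_⟩
  · rw [h1, h]
    simp
  · ext i
    rw [Pi.smul_apply, ← h3 i, ← Finsupp.smul_apply, ← map_smul, ← hs, h2]
    simp [leftBlock, Matrix.mulVec, dotProduct, mul_comm]
  · ext i
    change _ = t • v.repr δ _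
    rw [← Finsupp.smul_apply, ← map_smul, ← ht]
    conv_rhs => rw [h1]
    simp [rightBlock, Matrix.mulVec, dotProduct, mul_comm]

end IsAdapted

end Basis

theorem det_of_hasBlockForm {n a b c N : ℕ}
    {v : Module.Basis (BlockIndex n a b c) ℝ (Config N)}
    {A : Config N →ₗ[ℝ] Config N} {B C} (h : HasBlockForm v A B C) (p k : ℝ) :
    LinearMap.det (A + p • (1 : Config N →ₗ[ℝ] Config N) + k • J N) =
      ∏ j, (Matrix.fromBlocks (B j + p • 1) (k • 1) (-(k • 1)) (C j + p • 1)).det := by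
  rw [← det_blockDiagonal_dep, ← LinearMap.det_toMatrix v, add_right_comm, map_add, h k, map_smul,
    LinearMap.toMatrix_one, ← Matrix.blockDiagonal'_one, ← Matrix.blockDiagonal'_smul,
    ← Matrix.blockDiagonal'_add]
  congr 2
  funext j
  simp only [Pi.add_apply, Pi.smul_apply, Pi.one_apply]
  rw [← Matrix.fromBlocks_one, Matrix.fromBlocks_smul, Matrix.fromBlocks_add]
  simp

/-! ### Factorization of the stability polynomials -/

section Factorization

variable {n a b c N : ℕ} {v : Module.Basis (BlockIndex n a b c) ℝ (Config N)}
  {B C : (j : Block n) → Matrix (Fin (halfSize n a b c j)) (Fin (halfSize n a b c j)) ℝ}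

theorem finrank_config_eq (v : Module.Basis (BlockIndex n a b c) ℝ (Config N)) :
    Module.finrank ℝ (Config N) = ∑ j, 2 * halfSize n a b c j := by
  rw [Module.finrank_eq_card_basis v, Fintype.card_sigma]
  simp [two_mul]

/-- The identity is checked at every real `λ`. The degrees follow by comparing the total degree `4N`
with the bound for each factor in `λ`, then halving. -/
theorem stabilityPoly_eq_prod {γ ω : ℝ} {m : Fin N → ℝ} {x : Config N} (hm : ∀ i, m i ≠ 0)
    (h : HasBlockForm v (opA γ m x) B C) :
    stabilityPoly γ m ω x =
        ∏ j, (blockPoly (B j) (C j) (Polynomial.X - Polynomial.C (ω ^ 2))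
          (Polynomial.C (4 * ω ^ 2) * Polynomial.X)).comp (Polynomial.X ^ 2) ∧
      (∀ j, (blockPoly (B j) (C j) (Polynomial.X - Polynomial.C (ω ^ 2))
          (Polynomial.C (4 * ω ^ 2) * Polynomial.X)).natDegree = 2 * halfSize n a b c j) ∧
      ∀ (j : Block n) (l : ℝ), (blockPoly (B j) (C j) (Polynomial.X - Polynomial.C (ω ^ 2))
          (Polynomial.C (4 * ω ^ 2) * Polynomial.X)).eval (l ^ 2) =
        (Matrix.fromBlocks (B j + (l ^ 2 - ω ^ 2) • 1) ((2 * l * ω) • 1)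
          (-((2 * l * ω) • 1)) (C j + (l ^ 2 - ω ^ 2) • 1)).det := by
  have heval (j : Block n) (l : ℝ) : (blockPoly (B j) (C j) (Polynomial.X - Polynomial.C (ω ^ 2))
      (Polynomial.C (4 * ω ^ 2) * Polynomial.X)).eval (l ^ 2) =
      (Matrix.fromBlocks (B j + (l ^ 2 - ω ^ 2) • 1) ((2 * l * ω) • 1)
        (-((2 * l * ω) • 1)) (C j + (l ^ 2 - ω ^ 2) • 1)).det := by
    rw [eval_blockPoly (k := 2 * l * ω)]
    · simp
    · simp
      ring
  have hprod : stabilityPoly γ m ω x =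
      ∏ j, (blockPoly (B j) (C j) (Polynomial.X - Polynomial.C (ω ^ 2))
        (Polynomial.C (4 * ω ^ 2) * Polynomial.X)).comp (Polynomial.X ^ 2) := by
    refine Polynomial.funext fun l => ?_
    rw [stabilityPoly, eval_charpoly_eq_det, linearization,
      det_smul_id_sub_linearization (J N) (hess (potential γ m) x) (diagOp m) (diagOp m⁻¹)
        (J_mul_J N) (diagOp_mul_diagOp _ _ fun i => by simp [hm i]) (J_mul_diagOp _),
      Polynomial.eval_prod]
    refine (det_of_hasBlockForm h _ _).trans (Finset.prod_congr rfl fun j _ => ?_)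
    rw [Polynomial.eval_comp, Polynomial.eval_pow, Polynomial.eval_X, heval]
  refine ⟨hprod, fun j => ?_, heval⟩
  have hcomp (Q : ℝ[X]) : (Q.comp (Polynomial.X ^ 2)).natDegree = 2 * Q.natDegree := by
    rw [Polynomial.natDegree_comp, Polynomial.natDegree_X_pow, mul_comm]
  have hle (j : Block n) := natDegree_blockPoly_le (B j) (C j)
    (Polynomial.X - Polynomial.C (ω ^ 2)) (Polynomial.C (4 * ω ^ 2) * Polynomial.X)
    (Polynomial.natDegree_X_sub_C_le _)
    ((Polynomial.natDegree_C_mul_le _ _).trans (Polynomial.natDegree_X_le.trans (by norm_num)))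
  have hmonic : (stabilityPoly γ m ω x).Monic := LinearMap.charpoly_monic _
  have hdeg : (stabilityPoly γ m ω x).natDegree = ∑ j, 2 * (2 * halfSize n a b c j) := by
    rw [stabilityPoly, LinearMap.charpoly_natDegree, Module.finrank_prod, finrank_config_eq v]
    simp only [← Finset.mul_sum]
    ring
  have key := natDegree_eq_of_prod _ (fun j => 2 * (2 * halfSize n a b c j))
    (fun j => (hcomp _).trans_le (Nat.mul_le_mul_left 2 (hle j))) (hprod ▸ hmonic.ne_zero)
    (hprod ▸ hdeg) j
  rw [hcomp] at key
  exact Nat.eq_of_mul_eq_mul_left two_pos key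

/-- From `J² = -1` one has `λ - J(ω + A) = -J(A + ω + λJ)`, so the block determinants give the
polynomial once `det(-J) = 1` is known. -/
theorem vortexStabilityPoly_eq_prod {ω : ℝ} {m : Fin N → ℝ} {x : Config N}
    (h : HasBlockForm v (vortexOpA m x) B C) :
    vortexStabilityPoly m ω x =
        ∏ j, blockPoly (B j) (C j) (Polynomial.C ω) (Polynomial.X ^ 2) ∧
      (∀ j, (blockPoly (B j) (C j) (Polynomial.C ω) (Polynomial.X ^ 2)).natDegree =
        2 * halfSize n a b c j) ∧
      ∀ (j : Block n) (l : ℝ),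
        (blockPoly (B j) (C j) (Polynomial.C ω) (Polynomial.X ^ 2)).eval l =
          (Matrix.fromBlocks (B j + ω • 1) (l • 1) (-(l • 1)) (C j + ω • 1)).det := by
  have heval (j : Block n) (l : ℝ) :
      (blockPoly (B j) (C j) (Polynomial.C ω) (Polynomial.X ^ 2)).eval l =
        (Matrix.fromBlocks (B j + ω • 1) (l • 1) (-(l • 1)) (C j + ω • 1)).det := by
    rw [eval_blockPoly (k := l)]
    · simp
    · simp
  -- Subtracting the block form at scalar `0` isolates the matrix of `J`.
  have hJ : HasBlockForm v 0 0 0 := by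
    intro s
    have h1 := h s
    have h0 := h 0
    rw [zero_smul, add_zero] at h0
    rw [map_add, h0] at h1
    rw [zero_add, eq_sub_of_add_eq' h1, ← Matrix.blockDiagonal'_sub]
    congr 1
    funext j
    simp [sub_eq_add_neg, Matrix.fromBlocks_neg, Matrix.fromBlocks_add]
  have hdetJ : LinearMap.det (-J N) = 1 := by
    have h1 := det_of_hasBlockForm hJ 0 (-1)
    rw [zero_smul, add_zero, zero_add, neg_one_smul] at h1
    rw [h1]
    refine Finset.prod_eq_one fun j _ => ?_
    rw [det_fromBlocks_smul_one]
    simp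
  have hprod : vortexStabilityPoly m ω x =
      ∏ j, blockPoly (B j) (C j) (Polynomial.C ω) (Polynomial.X ^ 2) := by
    refine Polynomial.funext fun l => ?_
    have h1 : l • LinearMap.id - vortexLinearization m ω x =
        -J N * (vortexOpA m x + ω • (1 : Config N →ₗ[ℝ] Config N) + l • J N) := by
      have h2 : vortexLinearization m ω x =
        J N * (ω • (1 : Config N →ₗ[ℝ] Config N) + vortexOpA m x) := rfl
      have h3 : J N * (l • J N) = -(l • 1) := by rw [mul_smul_comm, J_mul_J, smul_neg]
      rw [h2, neg_mul, mul_add (J N) _ (l • J N), h3, add_comm (vortexOpA m x),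
        Module.End.one_eq_id]
      abel
    rw [vortexStabilityPoly, eval_charpoly_eq_det, h1, map_mul, hdetJ, one_mul,
      det_of_hasBlockForm h, Polynomial.eval_prod]
    exact Finset.prod_congr rfl fun j _ => (heval j l).symm
  refine ⟨hprod, fun j => ?_, heval⟩
  have hle (j : Block n) := natDegree_blockPoly_le (B j) (C j) (Polynomial.C ω)
    (Polynomial.X ^ 2) (by simp) (by simp)
  have hmonic : (vortexStabilityPoly m ω x).Monic := LinearMap.charpoly_monic _
  have hdeg : (vortexStabilityPoly m ω x).natDegree = ∑ j, 2 * halfSize n a b c j := by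
    rw [vortexStabilityPoly, LinearMap.charpoly_natDegree, finrank_config_eq v]
  exact natDegree_eq_of_prod _ _ hle (hprod ▸ hmonic.ne_zero) (hprod ▸ hdeg) j

end Factorization

/-! ### Factors from translations, rotation and homogeneity -/

section Distinguished

variable {n a b c N : ℕ} [NeZero n] {σ : DihedralGroup n →* Equiv.Perm (Fin N)}
  {m : Fin N → ℝ} {v : Module.Basis (BlockIndex n a b c) ℝ (Config N)}

theorem IsAdapted.splitsAt_last (hv : IsAdapted σ m v) {A : Config N →ₗ[ℝ] Config N}
    (hA : ∀ u w, massInner m (A u) w = massInner m u (A w)) (hH : A (transH N) = 0)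
    (hV : A (transV N) = 0) {i : Fin (halfSize n a b c (lastBlock n))}
    (hi : v ⟨lastBlock n, Sum.inl i⟩ = transV N) :
    SplitsAt (leftBlock v A (lastBlock n)) i ∧ leftBlock v A (lastBlock n) i i = 0 ∧
      SplitsAt (rightBlock v A (lastBlock n)) i ∧ rightBlock v A (lastBlock n) i i = 0 := by
  have h1 := hv.splitsAt_leftBlock hA (j := lastBlock n) (i := i) (t := 0) (by rw [hi, hV, zero_smul])
  have h2 := hv.splitsAt_rightBlock hA (j := lastBlock n) (i := i) (t := 0)
    (by rw [hv.inr_eq, hi, J_transV, neg_neg, hH, zero_smul])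
  exact ⟨h1.1, h1.2, h2⟩

theorem IsAdapted.splitsAt_first (hv : IsAdapted σ m v) {A : Config N →ₗ[ℝ] Config N}
    (hA : ∀ u w, massInner m (A u) w = massInner m u (A w)) {x : Config N} {s t : ℝ}
    (hs : A (J N x) = s • J N x) (ht : A x = t • x) {i : Fin (halfSize n a b c (firstBlock n))}
    (hi : v ⟨firstBlock n, Sum.inl i⟩ = J N x) :
    SplitsAt (leftBlock v A (firstBlock n)) i ∧ leftBlock v A (firstBlock n) i i = s ∧
      SplitsAt (rightBlock v A (firstBlock n)) i ∧ rightBlock v A (firstBlock n) i i = t := by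
  have h1 := hv.splitsAt_leftBlock hA (j := firstBlock n) (i := i) (t := s) (by rw [hi, hs])
  have h2 := hv.splitsAt_rightBlock hA (j := firstBlock n) (i := i) (t := t)
    (by rw [hv.inr_eq, hi, J_J, neg_neg, ht])
  exact ⟨h1.1, h1.2, h2⟩

theorem transH_ne_zero (hN : 0 < N) : transH N ≠ 0 := by
  intro h
  have := congrArg (fun q : Config N => q ⟨0, hN⟩ 0) h
  simp [transH] at this

theorem blockFreq_last (n : ℕ) : ((blockFreq n (lastBlock n) : ℕ) : ZMod n) = 1 := by
  simp [blockFreq, lastBlock]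

theorem blockFreq_first (n : ℕ) : ((blockFreq n (firstBlock n) : ℕ) : ZMod n) = 0 := by
  simp [blockFreq, firstBlock]

/-- The horizontal translation lies in the second half of the frequency-1 block, the vertical one in
the first, both with eigenvalue `0`. -/
theorem IsAdapted.dvd_last (hv : IsAdapted σ m v) (hn : 2 < n) (hN : 0 < N)
    (hm : ∀ g i, m (σ g i) = m i) {A : Config N →ₗ[ℝ] Config N} (hH : A (transH N) = 0)
    (hV : A (transV N) = 0) (p q : ℝ[X]) :
    p ^ 2 + q ∣ blockPoly (leftBlock v A (lastBlock n)) (rightBlock v A (lastBlock n)) p q := by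
  have hmem : transH N ∈ isoSpace σ (blockFreq n (lastBlock n) : ZMod n)
      (-blockSign n (lastBlock n)) := by
    have h := neg_J_mem_isoSpace σ (transV_mem_isoSpace σ hn)
    rw [J_transV, neg_neg] at h
    rwa [blockFreq_last]
  obtain ⟨β, hβ, h1, h2⟩ := hv.exists_eigenvector hn hm (A := A) (s := 0) (t := 0)
    (transH_ne_zero hN) hmem (by rw [J_transH, hV, zero_smul]) (by rw [hH, zero_smul])
  have h := dvd_blockPoly _ _ p q β hβ _ _ h1 h2
  simpa [sq] using h

/-- The invariant displacement `x` has sign `+1`; as the first half of this block has sign `-1`, `x`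
lies in the second half and `Jx` in the first. -/
theorem IsAdapted.dvd_first (hv : IsAdapted σ m v) (hn : 2 < n)
    (hm : ∀ g i, m (σ g i) = m i) {A : Config N →ₗ[ℝ] Config N} {x : Config N} (hx : x ≠ 0)
    (hσ : ∀ g i, x (σ g i) = act g (x i)) {s t : ℝ}
    (hs : A (J N x) = s • J N x) (ht : A x = t • x) (p q : ℝ[X]) :
    (Polynomial.C s + p) * (Polynomial.C t + p) + q ∣
      blockPoly (leftBlock v A (firstBlock n)) (rightBlock v A (firstBlock n)) p q := by
  have hmem : x ∈ isoSpace σ (blockFreq n (firstBlock n) : ZMod n)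
      (-blockSign n (firstBlock n)) := by
    rw [blockFreq_first]
    simpa [blockSign, firstBlock] using mem_isoSpace_of_rep_eq σ (rep_self σ hσ)
  obtain ⟨β, hβ, h1, h2⟩ := hv.exists_eigenvector hn hm hx hmem hs ht
  exact dvd_blockPoly _ _ p q β hβ _ _ h1 h2

end Distinguished

end RingSystem

/-! ### Assembly of the theorem -/

theorem mainTheorem1 (n a b c N : ℕ) (hn : 2 < n)
    (x : Config N) (hx : Function.Injective fun i => x i)
    (hX : IsRingSystem n (Set.range fun i => x i) a b c)
    (m : Fin N → ℝ) (hm : ∀ i, m i ≠ 0)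
    (hsymm : ∀ (g : DihedralGroup n) (i j : Fin N), act g (x i) = x j → m i = m j) :
    ∃ (v : Module.Basis (BlockIndex n a b c) ℝ (Config N))
      (i₀ : Fin (halfSize n a b c (lastBlock n)))
      (k₀ : Fin (halfSize n a b c (firstBlock n))),
      (∀ p q, p ≠ q → massInner m (v p) (v q) = 0) ∧
      (∑ i, m i ≠ 0 →
        v ⟨lastBlock n, Sum.inl i₀⟩ = transV N ∧ v ⟨lastBlock n, Sum.inr i₀⟩ = transH N) ∧
      (∑ i, m i * ‖x i‖ ^ 2 ≠ 0 →
        v ⟨firstBlock n, Sum.inl k₀⟩ = J N x ∧ v ⟨firstBlock n, Sum.inr k₀⟩ = x) ∧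
      -- the `N`-body problem
      (∀ γ : ℝ, γ ≠ -1 →
        opA γ m x (transH N) = 0 ∧ opA γ m x (transV N) = 0 ∧
        ∃ B C, HasBlockForm v (opA γ m x) B C ∧
          (∑ i, m i ≠ 0 →
            SplitsAt (B (lastBlock n)) i₀ ∧ B (lastBlock n) i₀ i₀ = 0 ∧
            SplitsAt (C (lastBlock n)) i₀ ∧ C (lastBlock n) i₀ i₀ = 0) ∧
          ∀ ω : ℝ, ω ≠ 0 →
            ∃ Q : Block n → ℝ[X],
              stabilityPoly γ m ω x = ∏ j, (Q j).comp (Polynomial.X ^ 2) ∧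
              (∀ j, (Q j).natDegree = 2 * halfSize n a b c j) ∧
              (∀ (j : Block n) (l : ℝ), (Q j).eval (l ^ 2) =
                (Matrix.fromBlocks (B j + (l ^ 2 - ω ^ 2) • 1) ((2 * l * ω) • 1)
                  (-((2 * l * ω) • 1)) (C j + (l ^ 2 - ω ^ 2) • 1)).det) ∧
              (Polynomial.X + Polynomial.C (ω ^ 2)) ^ 2 ∣ Q (lastBlock n) ∧
              (IsRelEquilibrium γ m ω x →
                opA γ m x x = ((2 * γ + 1) * ω ^ 2) • x ∧
                opA γ m x (J N x) = ω ^ 2 • J N x ∧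
                (∑ i, m i * ‖x i‖ ^ 2 ≠ 0 →
                  SplitsAt (B (firstBlock n)) k₀ ∧ B (firstBlock n) k₀ k₀ = ω ^ 2 ∧
                  SplitsAt (C (firstBlock n)) k₀ ∧
                  C (firstBlock n) k₀ k₀ = (2 * γ + 1) * ω ^ 2) ∧
                Polynomial.X * (Polynomial.X + Polynomial.C ((2 * γ + 4) * ω ^ 2)) ∣
                  Q (firstBlock n))) ∧
      -- the `N`-vortex problem
      (vortexOpA m x (transH N) = 0 ∧ vortexOpA m x (transV N) = 0 ∧
        ∃ B C, HasBlockForm v (vortexOpA m x) B C ∧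
          (∑ i, m i ≠ 0 →
            SplitsAt (B (lastBlock n)) i₀ ∧ B (lastBlock n) i₀ i₀ = 0 ∧
            SplitsAt (C (lastBlock n)) i₀ ∧ C (lastBlock n) i₀ i₀ = 0) ∧
          ∀ ω : ℝ, ω ≠ 0 →
            ∃ Q : Block n → ℝ[X],
              vortexStabilityPoly m ω x = ∏ j, Q j ∧
              (∀ j, (Q j).natDegree = 2 * halfSize n a b c j) ∧
              (∀ (j : Block n) (l : ℝ), (Q j).eval l =
                (Matrix.fromBlocks (B j + ω • 1) (l • 1) (-(l • 1)) (C j + ω • 1)).det) ∧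
              Polynomial.X ^ 2 + Polynomial.C (ω ^ 2) ∣ Q (lastBlock n) ∧
              (IsVortexRelEquilibrium m ω x →
                vortexOpA m x x = ω • x ∧
                vortexOpA m x (J N x) = (-ω) • J N x ∧
                (∑ i, m i * ‖x i‖ ^ 2 ≠ 0 →
                  SplitsAt (B (firstBlock n)) k₀ ∧ B (firstBlock n) k₀ k₀ = -ω ∧
                  SplitsAt (C (firstBlock n)) k₀ ∧ C (firstBlock n) k₀ k₀ = ω) ∧
                Polynomial.X ^ 2 ∣ Q (firstBlock n))) := by
  have : NeZero n := ⟨by omega⟩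
  obtain ⟨σ, hσ⟩ := exists_perm hx hX.symmetric
  have hmσ : ∀ g i, m (σ g i) = m i := fun g i => (hsymm g i _ (hσ g i).symm).symm
  obtain ⟨_, ⟨i₁, rfl⟩, _, ⟨i₂, rfl⟩, hne⟩ := hX.nontrivial
  have hN : 0 < N := i₁.pos
  have hx0 : x ≠ 0 := by
    rintro rfl
    exact hne rfl
  -- The vectors to be included in the basis; `0` is isotropic and so imposes nothing on the
  -- remaining blocks.
  let u : Block n → Config N
    | Sum.inl i => if (i : ℕ) = 0 then J N x else 0
    | Sum.inr (Sum.inl _) => 0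
    | Sum.inr (Sum.inr _) => transV N
  have hu : ∀ j, u j ∈ isoSpace σ (blockFreq n j : ZMod n) (blockSign n j) := by
    rintro (i | i | i)
    · simp only [u, blockFreq, blockSign]
      split_ifs
      · rw [Nat.cast_zero]
        exact J_mem_isoSpace σ (mem_isoSpace_of_rep_eq σ (rep_self σ hσ))
      · exact Submodule.zero_mem _
    · exact Submodule.zero_mem _
    · simpa [u, blockFreq, blockSign] using transV_mem_isoSpace σ hn
  obtain ⟨v, i, hv, hvu⟩ := exists_isAdapted σ hn hx hX hσ hm hmσ u hu
  have hlast (h : ∑ i, m i ≠ 0) : v ⟨lastBlock n, Sum.inl (i (lastBlock n))⟩ = transV N := by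
    refine hvu (lastBlock n) ?_
    have h1 : u (lastBlock n) = transV N := rfl
    rw [h1]
    -- The mass norm of a unit translation is the total mass.
    simpa [massInner, transV, EuclideanSpace.real_norm_sq_eq, Fin.sum_univ_two] using h
  have hfirst (h : ∑ i, m i * ‖x i‖ ^ 2 ≠ 0) :
      v ⟨firstBlock n, Sum.inl (i (firstBlock n))⟩ = J N x := by
    refine hvu (firstBlock n) ?_
    have h1 : u (firstBlock n) = J N x := if_pos rfl
    rw [h1, massInner_J_J]
    simpa [massInner, real_inner_self_eq_norm_sq] using h
  refine ⟨v, i (lastBlock n), i (firstBlock n), hv.orthogonal, fun h => ⟨hlast h, ?_⟩,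
    fun h => ⟨hfirst h, ?_⟩, fun γ hγ => ?_, ?_⟩
  · rw [hv.inr_eq, hlast h, J_transV, neg_neg]
  · rw [hv.inr_eq, hfirst h, J_J, neg_neg]
  · have hA : opA γ m x = pairOp (fun t => 1 / (2 * γ + 2) * t ^ (2 * γ + 2)) m x := by
      rw [opA, potential_eq_pairEnergy, pairOp]
    have hself : ∀ u w, massInner m (opA γ m x u) w = massInner m u (opA γ m x w) := by
      rw [hA]
      exact massInner_pairOp (contDiffAt_potential_profile γ) hx hm
    have hH : opA γ m x (transH N) = 0 := by rw [hA, pairOp_transH]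
    have hV : opA γ m x (transV N) = 0 := by rw [hA, pairOp_transV]
    have hform : HasBlockForm v (opA γ m x) (leftBlock v (opA γ m x))
        (rightBlock v (opA γ m x)) :=
      hv.hasBlockForm hn hmσ (by rw [hA]; exact pairOp_mul_rep hσ hmσ)
    refine ⟨hH, hV, _, _, hform, fun h => hv.splitsAt_last hself hH hV (hlast h), fun ω _ => ?_⟩
    obtain ⟨h1, h2, h3⟩ := stabilityPoly_eq_prod (ω := ω) hm hform
    refine ⟨_, h1, h2, h3, ?_, fun hrel => ?_⟩
    -- `(z - ω²)² + 4ω²z = (z + ω²)²`.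
    · convert! hv.dvd_last hn hN hmσ hH hV (Polynomial.X - Polynomial.C (ω ^ 2))
        (Polynomial.C (4 * ω ^ 2) * Polynomial.X) using 1
      simp only [map_mul, map_pow, map_ofNat]
      ring
    · have hg := hrel.gradient_eq hx hm
      rw [potential_eq_pairEnergy] at hg
      obtain ⟨e1, e2⟩ := pairOp_of_gradient_eq (contDiffAt_potential_profile γ) hx hm
        (p := 2 * γ + 2) (c := fun _ => 0)
        (fun t r ht hr => by rw [Real.mul_rpow ht.le hr.le]; ring) hg
      rw [← hA, show (2 * γ + 2 - 1) = 2 * γ + 1 by ring] at e1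
      rw [← hA] at e2
      refine ⟨e1, e2, fun h => hv.splitsAt_first hself e2 e1 (hfirst h), ?_⟩
      -- With `s = ω²` and `t = (2γ + 1)ω²` the factor is `z(z + 2γω²) + 4ω²z`.
      convert! hv.dvd_first hn hmσ hx0 hσ e2 e1 (Polynomial.X - Polynomial.C (ω ^ 2))
        (Polynomial.C (4 * ω ^ 2) * Polynomial.X) using 1
      simp only [map_mul, map_pow, map_ofNat, map_add, map_one]
      ring
  · have hA : vortexOpA m x = pairOp (fun t => -Real.log t) m x := by
      rw [vortexOpA, vortexH_eq_pairEnergy, pairOp]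
    have hself : ∀ u w, massInner m (vortexOpA m x u) w = massInner m u (vortexOpA m x w) := by
      rw [hA]
      exact massInner_pairOp contDiffAt_vortex_profile hx hm
    have hH : vortexOpA m x (transH N) = 0 := by rw [hA, pairOp_transH]
    have hV : vortexOpA m x (transV N) = 0 := by rw [hA, pairOp_transV]
    have hform : HasBlockForm v (vortexOpA m x) (leftBlock v (vortexOpA m x))
        (rightBlock v (vortexOpA m x)) :=
      hv.hasBlockForm hn hmσ (by rw [hA]; exact pairOp_mul_rep hσ hmσ)
    refine ⟨hH, hV, _, _, hform, fun h => hv.splitsAt_last hself hH hV (hlast h), fun ω _ => ?_⟩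
    obtain ⟨h1, h2, h3⟩ := vortexStabilityPoly_eq_prod (ω := ω) hform
    refine ⟨_, h1, h2, h3, ?_, fun hrel => ?_⟩
    · convert! hv.dvd_last hn hN hmσ hH hV (Polynomial.C ω) (Polynomial.X ^ 2) using 1
      simp only [map_pow]
      ring
    · have hg := hrel.gradient_eq hx
      rw [vortexH_eq_pairEnergy] at hg
      obtain ⟨e1, e2⟩ := pairOp_of_gradient_eq contDiffAt_vortex_profile hx hm
        -- The logarithm is homogeneous of degree `0` up to the additive constant `-log t`.
        (p := 0) (c := fun t => -Real.log t)
        (fun t r ht hr => by rw [Real.log_mul ht.ne' hr.ne', Real.rpow_zero]; ring) hg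
      rw [← hA, show (0 - 1) * -ω = ω by ring] at e1
      rw [← hA] at e2
      refine ⟨e1, e2, fun h => hv.splitsAt_first hself e2 e1 (hfirst h), ?_⟩
      -- With `s = -ω`, `t = ω` and `p = ω` the product `(s + p)(t + p)` vanishes and only `λ²`
      -- remains.
      convert! hv.dvd_first hn hmσ hx0 hσ e2 e1 (Polynomial.C ω) (Polynomial.X ^ 2) using 1
      simp
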